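/- **Definitions.** Let $\mathbb N=\{1,2,\dots\}$, $[n]=\{1,\dots,n\}$, $\mathbf x=(x_1,x_2,\dots)$, $\mathbf t=(t_1,t_2,\dots)$, and let $S_n$ be regarded as a subgroup of the group $S_\infty$ of finitary permutations of $\mathbb N$. *Noncrossing permutations.* A set partition of $[n]$ is noncrossing if there are no distinct blocks $P,Q$ with $a,b\in P$, $c,d\in Q$ and $a<c<b<d$. Its noncrossing permutation in $S_n$ is the product over its blocks $B=\{a_p>a_{p-1}>\dots>a_1\}$ of the cycles $(a_p\,a_{p-1}\cdots a_1)$, sending $a_p\mapsto a_{p-1}\mapsto\dots\mapsto a_1\mapsto a_p$. Let $\mathrm{NC}_n\subset S_n$ be the set of these permutations. The Bruhat order is: $\sigma\le\tau$ iff some reduced word of $\sigma$ in the adjacent transpositions is a subword of some reduced word of $\tau$. *Forests.* An indexed forest is a sequence $F=(T_1,T_2,\dots)$ of binary plane trees (every node has two children, left and right, or is a leaf), all but finitely many of which are the one-node tree; $\emptyset$ is the forest all of whose trees are trivial. The leaves of $F$ are labelled $1,2,3,\dots$ from left to right. $\mathsf{Forest}_n$ is the set of forests all of whose nontrivial trees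 have all their leaves in $[n]$. A terminal node is an internal node both of whose children are leaves; $\mathrm{QDes}(F)$ is the set of labels of left children of terminal nodes, and for $i\in\mathrm{QDes}(F)$ the forest $F/i$ is obtained by deleting the terminal node whose left child is the leaf $i$ (replacing it by a leaf). *The map $\mathrm{ForToNC}$.* For $F\in\mathsf{Forest}_n$, treat every internal node $v$ of $F$ that is a right child as follows: delete $v$, cut off its left subtree as a separate tree, and let the right child of $v$ take the place of $v$. The sets of leaves in $[n]$ of the resulting trees are the blocks of a set partition of $[n]$, and $\mathrm{ForToNC}(F)$ is the product of the backwards cycles, as above, of these blocks. *Double forest polynomials.* For $f\in\mathbb Z[\mathbf t][\mathbf x]$ put $$\mathsf E_i f=\frac{f(x_1,\dots,x_{i-1},x_i,t_i,x_{i+1},\dots;\mathbf t)-f(x_1,\dots,x_{i-1},t_i,x_i,x_{i+1},\dots;\mathbf t)}{x_i-t_i},$$ and $\operatorname{ev}_\sigma f=f(t_{\sigma(1)},t_{\sigma(2)},\dots;\mathbf t)\in\mathbb Z[\mathbf t]$ for $\sigma\in S_\infty$. The double forest polynomials are the unique family $(\mathfrak P_F)$, indexed by all indexed forests $F$, of polynomials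 in $\mathbb Z[\mathbf t][\mathbf x]$, each homogeneous in the variables $\mathbf x$ and $\mathbf t$ together, such that $\mathfrak P_F(\mathbf t;\mathbf t)$ is $1$ if $F=\emptyset$ and $0$ otherwise, and such that for every $i$, $\mathsf E_i\mathfrak P_F=\mathfrak P_{F/i}(\mathbf x;t_1,\dots,t_{i-1},t_{i+1},\dots)$ if $i\in\mathrm{QDes}(F)$ and $\mathsf E_i\mathfrak P_F=0$ otherwise. **Theorem.** There is exactly one family $(\mathfrak P_F)$ as above, and for every $n\ge 0$: 1. $\mathrm{ForToNC}$ is a bijection from $\mathsf{Forest}_n$ to $\mathrm{NC}_n$. 2. For all $\sigma\in\mathrm{NC}_n$ and $F\in\mathsf{Forest}_n$, $\operatorname{ev}_\sigma(\mathfrak P_F)=0$ if and only if $\mathrm{ForToNC}(F)\not\le\sigma$ in the Bruhat order. 3. Hence evaluations of double forest polynomials characterize the Bruhat order restricted to $\mathrm{NC}_n$: for all $\sigma,\tau\in\mathrm{NC}_n$, $\tau\le\sigma$ if and only if $\operatorname{ev}_\sigma(\mathfrak P_{\mathrm{ForToNC}^{-1}(\tau)})\ne 0$. -/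

import Mathlib

/-
Everything is indexed from `0`: the label, variable or letter written `i + 1` with positive
integers is `i : ℕ` here, and `[n]` is `{0, …, n - 1}`.
-/

namespace DoubleForest

/-! ### Permutations, noncrossing partitions and the Bruhat order -/

/-- The adjacent transposition exchanging `i` and `i + 1`. -/
def simpleTransposition (i : ℕ) : Equiv.Perm ℕ := Equiv.swap i (i + 1)

/-- The product of adjacent transpositions spelled by a word. -/
def wordProd (w : List ℕ) : Equiv.Perm ℕ := (w.map simpleTransposition).prod

/-- `w` is a reduced word of `σ`: a shortest word in the adjacent transpositions whose
product is `σ`. -/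
def IsReducedWord (w : List ℕ) (σ : Equiv.Perm ℕ) : Prop :=
  wordProd w = σ ∧ ∀ v : List ℕ, wordProd v = σ → w.length ≤ v.length

/-- The strong Bruhat order: some reduced word of `σ` is a subword of some reduced word of `τ`.
(The finite symmetric group on `[n]` sits in the finitary permutations of `ℕ`; reduced words
of its elements only use the letters `i` with `i + 1 < n`.) -/
def BruhatLE (σ τ : Equiv.Perm ℕ) : Prop :=
  ∃ v w : List ℕ, IsReducedWord v σ ∧ IsReducedWord w τ ∧ v.Sublist w

/-- The backwards cycle `(a_p a_{p-1} ⋯ a_1)` of a finite set `{a_p > a_{p-1} > ⋯ > a_1}`,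
sending each element to the next smaller one and the minimum to the maximum. -/
def backwardCycle (B : Finset ℕ) : Equiv.Perm ℕ := (B.sort (· ≥ ·)).formPerm

/-- The product of the backwards cycles of a list of blocks. It is used for pairwise disjoint
blocks only, where the cycles commute and the order of the list does not matter. -/
def blocksPerm (L : List (Finset ℕ)) : Equiv.Perm ℕ := (L.map backwardCycle).prod

/-- A set partition of `[n]` is noncrossing if no two distinct blocks contain
`a < c < b < d` with `a, b` in the one and `c, d` in the other. -/
def IsNoncrossing {n : ℕ} (P : Finpartition (Finset.range n)) : Prop :=
  ∀ B ∈ P.parts, ∀ C ∈ P.parts, B ≠ C →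
    ∀ a ∈ B, ∀ b ∈ B, ∀ c ∈ C, ∀ d ∈ C, ¬ (a < c ∧ c < b ∧ b < d)

/-- The noncrossing permutations of `[n]`, as permutations of `ℕ` fixing all `i ≥ n`. -/
def noncrossingPerms (n : ℕ) : Set (Equiv.Perm ℕ) :=
  {σ | ∃ P : Finpartition (Finset.range n), IsNoncrossing P ∧ σ = blocksPerm P.parts.toList}

/-! ### Indexed forests -/

/-- An indexed forest: a sequence of binary plane trees, all but finitely many of them trivial.
`BinaryTree.nil` is the trivial tree (a leaf), `BinaryTree.node` an internal node. -/
structure IndexedForest where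
  tree : ℕ → BinaryTree Unit
  finite_nontrivial : {i | tree i ≠ BinaryTree.nil}.Finite

namespace IndexedForest

/-- The empty forest, all of whose trees are trivial. -/
def empty : IndexedForest where
  tree _ := BinaryTree.nil
  finite_nontrivial := by simp

instance : Nonempty IndexedForest := ⟨empty⟩

/-- The label of the leftmost leaf of the `i`-th tree, the leaves of the forest being labelled
by `0, 1, 2, …` from left to right. -/
def start (F : IndexedForest) (i : ℕ) : ℕ :=
  ∑ j ∈ Finset.range i, (F.tree j).numLeaves

/-- The labels of the leaves of the nontrivial trees. -/
def supp (F : IndexedForest) : Set ℕ :=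
  {k | ∃ i, F.tree i ≠ BinaryTree.nil ∧ F.start i ≤ k ∧ k < F.start i + (F.tree i).numLeaves}

end IndexedForest

/-- The forests supported on `[n]`. -/
def forestsOn (n : ℕ) : Set IndexedForest := {F | F.supp ⊆ {k | k < n}}

/-- For a tree with leaves `k, k + 1, …`, the labels of the left children of its terminal nodes
(the internal nodes both of whose children are leaves). -/
def terminalLabels : BinaryTree Unit → ℕ → Set ℕ
  | .nil, _ => ∅
  | .node _ l r, k =>
      {i | l = .nil ∧ r = .nil ∧ i = k} ∪ terminalLabels l k ∪ terminalLabels r (k + l.numLeaves)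

/-- For a tree with leaves `k, k + 1, …`, delete the terminal node whose left child is
the leaf `i` (turning it into a leaf), if there is one. -/
def trimTree (i : ℕ) : BinaryTree Unit → ℕ → BinaryTree Unit
  | .nil, _ => .nil
  | .node _ l r, k =>
      if l = .nil ∧ r = .nil ∧ i = k then .nil
      else .node () (trimTree i l k) (trimTree i r (k + l.numLeaves))

namespace IndexedForest

/-- The set `QDes(F)` of the labels of the leaves reached from the terminal nodes of `F`
by going down left edges. -/
def qDes (F : IndexedForest) : Set ℕ := {i | ∃ j, i ∈ terminalLabels (F.tree j) (F.start j)}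

/-- The trimmed forest `F / i`, for `i ∈ QDes(F)`: delete the terminal node of `F` whose
left child is the leaf `i`. -/
def trim (F : IndexedForest) (i : ℕ) : IndexedForest where
  tree j := trimTree i (F.tree j) (F.start j)
  finite_nontrivial := by
    refine F.finite_nontrivial.subset fun j hj h => hj ?_
    simp [h, trimTree]

end IndexedForest

/-! ### From forests to noncrossing permutations -/

/-- Binary plane trees with labelled leaves: the trees of nested forests. -/
inductive LabelledTree where
  | leaf (a : ℕ) : LabelledTree
  | node (l r : LabelledTree) : LabelledTree

/-- The set of leaf labels. -/
def LabelledTree.leaves : LabelledTree → Finset ℕ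
  | .leaf a => {a}
  | .node l r => l.leaves ∪ r.leaves

/-- Label the leaves of a tree by `k, k + 1, …` from left to right. -/
def labelTree : BinaryTree Unit → ℕ → LabelledTree
  | .nil, k => .leaf k
  | .node _ l r, k => .node (labelTree l k) (labelTree r (k + l.numLeaves))

/-- Delete the left edge of every internal node that is a right child. The first argument says
whether the root of the given subtree is itself a right child. The result consists of the tree
that takes the place of the given one and the list of the trees that have been cut off:
if an internal node `v` is a right child, then its left subtree is cut off, `v` is deleted, and
its right child takes the place of `v`. -/
def cutLeftEdges : Bool → LabelledTree → LabelledTree × List LabelledTree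
  | _, .leaf a => (.leaf a, [])
  | false, .node l r =>
      (.node (cutLeftEdges false l).1 (cutLeftEdges true r).1,
        (cutLeftEdges false l).2 ++ (cutLeftEdges true r).2)
  | true, .node l r =>
      ((cutLeftEdges true r).1,
        (cutLeftEdges false l).1 :: ((cutLeftEdges false l).2 ++ (cutLeftEdges true r).2))

namespace IndexedForest

/-- The trees of the nested forest `LC(F)` that come from the `i`-th tree of `F`. -/
def lcTrees (F : IndexedForest) (i : ℕ) : List LabelledTree :=
  (cutLeftEdges false (labelTree (F.tree i) (F.start i))).1 ::
    (cutLeftEdges false (labelTree (F.tree i) (F.start i))).2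

/-- The blocks contained in `[n]` of the noncrossing partition given by the leaf sets of the trees
of `LC(F)`. As all leaves of the `i`-th tree of `F` are at least `i`, these blocks come from
the first `n` trees. -/
def lcBlocks (n : ℕ) (F : IndexedForest) : List (Finset ℕ) :=
  (((List.range n).flatMap F.lcTrees).map LabelledTree.leaves).filter (· ⊆ Finset.range n)

/-- The map `ForToNC` from forests supported on `[n]` to noncrossing permutations of `[n]`. -/
def forToNC (n : ℕ) (F : IndexedForest) : Equiv.Perm ℕ := blocksPerm (F.lcBlocks n)

end IndexedForest

/-! ### Double forest polynomials -/

noncomputable section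

open MvPolynomial

/-- The ring `ℤ[t][x]`, as the polynomials in the variables `x i` and `t i` for `i : ℕ`. -/
abbrev PolTX : Type := MvPolynomial (ℕ ⊕ ℕ) ℤ

/-- The variable `x_i`. -/
def x (i : ℕ) : PolTX := X (Sum.inl i)

/-- The variable `t_i`. -/
def t (i : ℕ) : PolTX := X (Sum.inr i)

/-- `R_i^- f = f(x_1, …, x_{i-1}, t_i, x_i, x_{i+1}, …; t)`. -/
def bergeronSottileMinus (i : ℕ) : PolTX →ₐ[ℤ] PolTX :=
  aeval (Sum.elim (fun j => if j < i then x j else if j = i then t i else x (j - 1)) t)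

/-- `R_i^+ f = f(x_1, …, x_{i-1}, x_i, t_i, x_{i+1}, …; t)`. -/
def bergeronSottilePlus (i : ℕ) : PolTX →ₐ[ℤ] PolTX :=
  aeval (Sum.elim (fun j => if j ≤ i then x j else if j = i + 1 then t i else x (j - 1)) t)

theorem sub_dvd_bergeronSottile_sub (i : ℕ) (f : PolTX) :
    x i - t i ∣ bergeronSottilePlus i f - bergeronSottileMinus i f := by
  rw [← Ideal.mem_span_singleton, ← Ideal.Quotient.mk_eq_mk_iff_sub_mem]
  have hxt : Ideal.Quotient.mkₐ ℤ (Ideal.span {x i - t i}) (x i) =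
      Ideal.Quotient.mkₐ ℤ (Ideal.span {x i - t i}) (t i) := by
    simp only [Ideal.Quotient.mkₐ_eq_mk]
    rw [Ideal.Quotient.mk_eq_mk_iff_sub_mem]
    exact Ideal.mem_span_singleton_self _
  have h : (Ideal.Quotient.mkₐ ℤ (Ideal.span {x i - t i})).comp (bergeronSottilePlus i) =
      (Ideal.Quotient.mkₐ ℤ (Ideal.span {x i - t i})).comp (bergeronSottileMinus i) := by
    apply MvPolynomial.algHom_ext
    rintro (j | j)
    · simp only [AlgHom.comp_apply, bergeronSottilePlus, bergeronSottileMinus, aeval_X,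
        Sum.elim_inl]
      rcases lt_trichotomy j i with hj | hj | hj
      · simp [hj, hj.le]
      · subst hj
        simpa using hxt
      · rcases eq_or_ne j (i + 1) with rfl | hj'
        · simpa using hxt.symm
        · simp [hj.not_gt, hj.not_ge, hj.ne', hj']
    · simp [bergeronSottilePlus, bergeronSottileMinus]
  exact DFunLike.congr_fun h f

/-- The equivariant trimming operation `E_i f = (R_i^+ f - R_i^- f) / (x_i - t_i)`. -/
def equivariantTrim (i : ℕ) (f : PolTX) : PolTX :=
  (sub_dvd_bergeronSottile_sub i f).choose

theorem mul_equivariantTrim (i : ℕ) (f : PolTX) :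
    (x i - t i) * equivariantTrim i f = bergeronSottilePlus i f - bergeronSottileMinus i f :=
  (sub_dvd_bergeronSottile_sub i f).choose_spec.symm

/-- The evaluation `ev_σ f = f(t_{σ(1)}, t_{σ(2)}, …; t)`, with values in `ℤ[t]`. -/
def ev (σ : Equiv.Perm ℕ) : PolTX →ₐ[ℤ] MvPolynomial ℕ ℤ :=
  aeval (Sum.elim (fun i => X (σ i)) X)

/-- The substitution `f(x; t) ↦ f(x; t_1, …, t_{i-1}, t_{i+1}, …)` that skips `t_i`. -/
def omitT (i : ℕ) : PolTX →ₐ[ℤ] PolTX :=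
  aeval (Sum.elim x (fun j => if j < i then t j else t (j + 1)))

open Classical in
/-- The defining properties of the family of double forest polynomials: homogeneity,
`P_F(t; t) = δ_{F, ∅}`, and `E_i P_F` is `P_{F / i}(x; t_1, …, t_{i-1}, t_{i+1}, …)` for
`i ∈ QDes(F)` and `0` otherwise. -/
structure IsDoubleForestFamily (P : IndexedForest → PolTX) : Prop where
  homogeneous : ∀ F, ∃ d, (P F).IsHomogeneous d
  normalized : ∀ F, ev 1 (P F) = if F = IndexedForest.empty then 1 else 0
  trimming : ∀ F i, equivariantTrim i (P F) = if i ∈ F.qDes then omitT i (P (F.trim i)) else 0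

/-- The double forest polynomials: the family with the defining properties
`IsDoubleForestFamily`. (That there is exactly one such family is part of the theorem.) -/
def doubleForestPoly : IndexedForest → PolTX := Classical.epsilon IsDoubleForestFamily

end

end DoubleForest

open DoubleForest

/-!
A forest other than `∅` has the form `F = G.graft i`, and the double forest polynomial of `F` is
recovered from those of the trimmed forests `F / i` by integrating the relations
`E_i P_F = P_{F / i}`, whose compatibility is the commutation relation of the operators `E_i`.

For a permutation `σ`, let `insertDesc i σ` and `insertAsc i σ` be obtained by inserting the letter
`i` next to position `i` of the one-line form, on the sides that give a descent or an ascent. Then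
`ForToNC (G.graft i) = insertDesc i (ForToNC G)`, and conversely every noncrossing permutation
other than `1` is of the form `insertDesc i σ` for a noncrossing `σ`, which proves bijectivity. The
definition of `E_i` turns into the recursion

  `ev (insertDesc i σ) P_F = ev (insertAsc i σ) P_F + (weight) * ev σ P_{F / i}`,

with the last term missing unless `i ∈ QDes F`. The weight is of the form `t_b - t_a` with `a < b`,
so nothing cancels at a strictly increasing sequence of parameters, and it remains to see when some
term survives. The same recursion governs the comparison of the ranks `#{k < a | b ≤ σ k}` with
`a = b` or `a = b + 1`. For noncrossing permutations this comparison is the Bruhat order, because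
the recursion also constructs a reduced word of the larger permutation together with a subword for
the smaller one.
-/

namespace DoubleForest

open MvPolynomial

/-! ### Inserting an equivariant parameter among the variables -/

section InsertT

/-- The substitution `f ↦ f(x_0, …, x_{i-1}, t_a, x_i, x_{i+1}, …; t)`. Both operators `R_i^±`
are of this form. -/
noncomputable def insertT (i a : ℕ) : PolTX →ₐ[ℤ] PolTX :=
  aeval (Sum.elim (fun j => if j < i then x j else if j = i then t a else x (j - 1)) t)

theorem insertT_x (i a j : ℕ) :
    insertT i a (x j) = if j < i then x j else if j = i then t a else x (j - 1) := by
  simp [insertT, x]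

@[simp] theorem insertT_t (i a j : ℕ) : insertT i a (t j) = t j := by
  simp [insertT, t]

theorem insertT_x_of_lt {i j : ℕ} (a : ℕ) (h : j < i) : insertT i a (x j) = x j := by
  simp [insertT_x, h]

@[simp] theorem insertT_x_self (i a : ℕ) : insertT i a (x i) = t a := by
  simp [insertT_x]

theorem insertT_x_succ_of_le {i j : ℕ} (a : ℕ) (h : i ≤ j) : insertT i a (x (j + 1)) = x j := by
  rw [insertT_x, if_neg (by omega), if_neg (by omega), Nat.add_sub_cancel]

theorem bergeronSottileMinus_eq_insertT (i : ℕ) : bergeronSottileMinus i = insertT i i := rfl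

theorem bergeronSottilePlus_eq_insertT (i : ℕ) : bergeronSottilePlus i = insertT (i + 1) i := by
  simp only [bergeronSottilePlus, insertT, Nat.lt_succ_iff]

theorem algHom_ext_x_t {A : Type*} [CommSemiring A] [Algebra ℤ A] {φ ψ : PolTX →ₐ[ℤ] A}
    (hx : ∀ j, φ (x j) = ψ (x j)) (ht : ∀ j, φ (t j) = ψ (t j)) : φ = ψ :=
  MvPolynomial.algHom_ext (Sum.forall.2 ⟨hx, ht⟩)

theorem insertT_comp_insertT {p q : ℕ} (hpq : p ≤ q) (a b : ℕ) :
    (insertT p a).comp (insertT (q + 1) b) = (insertT q b).comp (insertT p a) := by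
  refine algHom_ext_x_t (fun j => ?_) (by simp)
  simp only [AlgHom.comp_apply]
  rcases lt_trichotomy j p with h | rfl | h
  · rw [insertT_x_of_lt _ (by omega), insertT_x_of_lt _ h, insertT_x_of_lt _ (by omega)]
  · rw [insertT_x_of_lt _ (by omega), insertT_x_self, insertT_t]
  obtain ⟨j, rfl⟩ := Nat.exists_eq_add_of_lt h
  rw [insertT_x_succ_of_le a (by omega)]
  rcases lt_trichotomy (p + j) q with h' | rfl | h'
  · rw [insertT_x_of_lt _ (by omega), insertT_x_of_lt _ h', insertT_x_succ_of_le _ (by omega)]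
  · rw [insertT_x_self, insertT_x_self, insertT_t]
  · obtain ⟨k, hk⟩ := Nat.exists_eq_add_of_lt h'
    rw [insertT_x_succ_of_le _ (by omega), hk, insertT_x_succ_of_le _ (by omega),
      insertT_x_succ_of_le _ (by omega)]

/-- The difference of the substitutions that put `t_a` behind and before the variable `x_m`: the
numerator of `E_m`, but with an arbitrary parameter. -/
noncomputable def insertDiff (m a : ℕ) : PolTX →ₗ[ℤ] PolTX :=
  (insertT (m + 1) a).toLinearMap - (insertT m a).toLinearMap

theorem insertDiff_apply (m a : ℕ) (f : PolTX) :
    insertDiff m a f = insertT (m + 1) a f - insertT m a f := rfl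

theorem insertDiff_insertDiff {i m : ℕ} (h : i < m) (a b : ℕ) (f : PolTX) :
    insertDiff m b (insertDiff i a f) = insertDiff i a (insertDiff (m + 1) b f) := by
  have hcomm {p q : ℕ} (hpq : p ≤ q) :
      insertT p a (insertT (q + 1) b f) = insertT q b (insertT p a f) :=
    DFunLike.congr_fun (insertT_comp_insertT hpq a b) f
  simp only [insertDiff_apply, map_sub]
  rw [hcomm (by omega : i + 1 ≤ m + 1), hcomm (by omega : i + 1 ≤ m), hcomm (by omega : i ≤ m + 1),
    hcomm h.le]
  ring

theorem insertDiff_sub_mul_of_lt {j m : ℕ} (h : j < m) (a b : ℕ) (f : PolTX) :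
    insertDiff m a ((x j - t b) * f) = (x j - t b) * insertDiff m a f := by
  simp only [insertDiff_apply, map_mul, map_sub, insertT_t]
  rw [insertT_x_of_lt _ h, insertT_x_of_lt _ (by omega), mul_sub]

theorem insertDiff_sub_mul_of_gt {j m : ℕ} (h : m < j) (a b : ℕ) (f : PolTX) :
    insertDiff m a ((x (j + 1) - t b) * f) = (x j - t b) * insertDiff m a f := by
  simp only [insertDiff_apply, map_mul, map_sub, insertT_t]
  rw [insertT_x_succ_of_le _ h, insertT_x_succ_of_le _ h.le, mul_sub]

end InsertT

/-! ### Polynomials in the first few variables `x` -/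

section FirstVars

/-- The subalgebra `ℤ[t][x_0, …, x_{k-1}]` of `ℤ[t][x]`. -/
noncomputable def firstVars (k : ℕ) : Subalgebra ℤ PolTX :=
  supported ℤ {v | ∀ j, v = Sum.inl j → j < k}

variable {k : ℕ} {f : PolTX}

theorem x_mem_firstVars {j : ℕ} (h : j < k) : x j ∈ firstVars k :=
  X_mem_supported.2 (by rintro _ ⟨rfl⟩; exact h)

theorem t_mem_firstVars (j k : ℕ) : t j ∈ firstVars k :=
  X_mem_supported.2 (by simp)

theorem firstVars_mono : Monotone firstVars := fun _ _ h =>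
  supported_mono fun _ hv j hj => (hv j hj).trans_le h

theorem exists_mem_firstVars (f : PolTX) : ∃ k, f ∈ firstVars k := by
  obtain ⟨k, hk⟩ := (f.vars.image (Sum.elim id fun _ => 0)).bddAbove
  refine ⟨k + 1, mem_supported.2 fun v hv j hj => Nat.lt_succ_of_le (hk ?_)⟩
  rw [Finset.mem_coe, Finset.mem_image]
  exact ⟨v, hv, by rw [hj]; rfl⟩

theorem firstVars_le {S : Subalgebra ℤ PolTX} (hx : ∀ j < k, x j ∈ S) (ht : ∀ j, t j ∈ S) :
    firstVars k ≤ S := by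
  refine Algebra.adjoin_le ?_
  rintro _ ⟨j | j, hv, rfl⟩
  exacts [hx j (hv j rfl), ht j]

theorem insertT_of_mem_firstVars {i : ℕ} (h : k ≤ i) (a : ℕ) (hf : f ∈ firstVars k) :
    insertT i a f = f := by
  have hle : firstVars k ≤ AlgHom.equalizer (insertT i a) (AlgHom.id ℤ PolTX) :=
    firstVars_le (fun j hj => insertT_x_of_lt a (hj.trans_le h)) (fun j => insertT_t _ _ _)
  exact hle hf

theorem insertT_mem_firstVars (a : ℕ) (hf : f ∈ firstVars (k + 1)) :
    insertT k a f ∈ firstVars k := by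
  have hle : firstVars (k + 1) ≤ (firstVars k).comap (insertT k a) := by
    refine firstVars_le (fun j hj => ?_) (fun j => ?_) <;> rw [Subalgebra.mem_comap]
    · rcases Nat.lt_succ_iff_lt_or_eq.1 hj with hj | rfl
      · rw [insertT_x_of_lt _ hj]; exact x_mem_firstVars hj
      · rw [insertT_x_self]; exact t_mem_firstVars _ _
    · rw [insertT_t]; exact t_mem_firstVars _ _
  exact hle hf

theorem insertDiff_of_mem_firstVars {m : ℕ} (h : k ≤ m) (a : ℕ) (hf : f ∈ firstVars k) :
    insertDiff m a f = 0 := by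
  rw [insertDiff_apply, insertT_of_mem_firstVars (by omega) a hf, insertT_of_mem_firstVars h a hf,
    sub_self]

theorem mem_firstVars_of_insertDiff_eq_zero {a : ℕ} (hf : f ∈ firstVars (k + 1))
    (h : insertDiff k a f = 0) : f ∈ firstVars k := by
  rw [insertDiff_apply, insertT_of_mem_firstVars le_rfl a hf, sub_eq_zero] at h
  rw [h]
  exact insertT_mem_firstVars a hf

theorem mem_firstVars_of_forall_insertDiff_eq_zero (a : ℕ → ℕ)
    (h : ∀ m, k ≤ m → insertDiff m (a m) f = 0) : f ∈ firstVars k := by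
  obtain ⟨n, hn⟩ := exists_mem_firstVars f
  have descend (d : ℕ) : f ∈ firstVars (k + d) → f ∈ firstVars k := by
    induction d with
    | zero => exact id
    | succ d ih =>
      exact fun hd => ih (mem_firstVars_of_insertDiff_eq_zero hd (h _ (Nat.le_add_right _ _)))
  exact descend n (firstVars_mono (Nat.le_add_left _ _) hn)

theorem rename_inr_mem_firstVars_zero (p : MvPolynomial ℕ ℤ) :
    (rename Sum.inr p : PolTX) ∈ firstVars 0 := by
  refine mem_supported.2 fun v hv j hj => ?_
  have := vars_rename Sum.inr p hv
  simp [hj] at this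

theorem ev_x (σ : Equiv.Perm ℕ) (j : ℕ) : ev σ (x j) = X (σ j) := by simp [ev, x]

theorem ev_t (σ : Equiv.Perm ℕ) (j : ℕ) : ev σ (t j) = X j := by simp [ev, t]

theorem ev_rename_inr (σ : Equiv.Perm ℕ) (p : MvPolynomial ℕ ℤ) :
    ev σ (rename Sum.inr p) = p := by
  rw [ev, aeval_rename, Sum.elim_comp_inr, aeval_X_left_apply]

theorem rename_inr_ev_of_mem_firstVars_zero (σ : Equiv.Perm ℕ) (hf : f ∈ firstVars 0) :
    rename Sum.inr (ev σ f) = f := by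
  have hle : firstVars 0 ≤ AlgHom.equalizer ((rename Sum.inr).comp (ev σ)) (AlgHom.id ℤ PolTX) :=
    firstVars_le (by simp) fun j => by
      rw [AlgHom.mem_equalizer, AlgHom.comp_apply, ev_t, rename_X]
      rfl
  exact hle hf

end FirstVars

/-! ### The equivariant trimming operations -/

section EquivariantTrim

theorem x_sub_t_ne_zero (i j : ℕ) : x i - t j ≠ 0 := by
  simp [x, t, sub_eq_zero, X_inj]

theorem sub_mul_equivariantTrim (i : ℕ) (f : PolTX) :
    (x i - t i) * equivariantTrim i f = insertDiff i i f := by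
  rw [mul_equivariantTrim, bergeronSottilePlus_eq_insertT, bergeronSottileMinus_eq_insertT,
    insertDiff_apply]

theorem equivariantTrim_eq_iff {i : ℕ} {f g : PolTX} :
    equivariantTrim i f = g ↔ insertDiff i i f = (x i - t i) * g := by
  rw [← sub_mul_equivariantTrim, mul_right_inj' (x_sub_t_ne_zero i i)]

theorem equivariantTrim_add (i : ℕ) (f g : PolTX) :
    equivariantTrim i (f + g) = equivariantTrim i f + equivariantTrim i g := by
  rw [equivariantTrim_eq_iff, mul_add, sub_mul_equivariantTrim, sub_mul_equivariantTrim, map_add]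

theorem equivariantTrim_sub (i : ℕ) (f g : PolTX) :
    equivariantTrim i (f - g) = equivariantTrim i f - equivariantTrim i g := by
  rw [equivariantTrim_eq_iff, mul_sub, sub_mul_equivariantTrim, sub_mul_equivariantTrim, map_sub]

theorem equivariantTrim_of_mem_firstVars {k i : ℕ} (h : k ≤ i) {f : PolTX}
    (hf : f ∈ firstVars k) : equivariantTrim i f = 0 := by
  rw [equivariantTrim_eq_iff, mul_zero, insertDiff_of_mem_firstVars h i hf]

theorem equivariantTrim_sub_mul {k : ℕ} {f : PolTX} (hf : f ∈ firstVars (k + 1)) :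
    equivariantTrim k ((x k - t k) * f) = f := by
  rw [equivariantTrim_eq_iff, insertDiff_apply, map_mul, map_mul,
    insertT_of_mem_firstVars le_rfl _ hf]
  simp [insertT_x_of_lt]

theorem eq_zero_of_forall_equivariantTrim_eq_zero {f : PolTX} (h : ∀ i, equivariantTrim i f = 0)
    (h1 : ev 1 f = 0) : f = 0 := by
  have hf : f ∈ firstVars 0 := mem_firstVars_of_forall_insertDiff_eq_zero id fun i _ => by
    rw [id, ← sub_mul_equivariantTrim, h, mul_zero]
  rw [← rename_inr_ev_of_mem_firstVars_zero 1 hf, h1, map_zero]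

/-- The relations satisfied by the trimmings `g i = E_i f` of one polynomial `f`. They express the
commutation relation of `E_i` and `E_m` without mentioning `f`. -/
def TrimCompatible (g : ℕ → PolTX) : Prop :=
  ∀ i m, i < m → insertDiff m (m + 1) (g i) = (x m - t (m + 1)) * equivariantTrim i (g (m + 1))

theorem trimCompatible_equivariantTrim (f : PolTX) :
    TrimCompatible fun i => equivariantTrim i f := by
  intro i m h
  apply mul_left_cancel₀ (x_sub_t_ne_zero i i)
  calc (x i - t i) * insertDiff m (m + 1) (equivariantTrim i f)
      = insertDiff m (m + 1) (insertDiff i i f) := by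
        rw [← insertDiff_sub_mul_of_lt h, sub_mul_equivariantTrim]
    _ = insertDiff i i ((x (m + 1) - t (m + 1)) * equivariantTrim (m + 1) f) := by
        rw [insertDiff_insertDiff h, sub_mul_equivariantTrim]
    _ = (x i - t i) * ((x m - t (m + 1)) * equivariantTrim i (equivariantTrim (m + 1) f)) := by
        rw [insertDiff_sub_mul_of_gt h, ← sub_mul_equivariantTrim, mul_left_comm]

end EquivariantTrim

/-! ### Homogeneity -/

section Homogeneity

theorem isHomogeneous_of_mul_left {ι R : Type*} [CommRing R] [IsDomain R] {p q : MvPolynomial ι R}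
    {d e : ℕ} (hp : p.IsHomogeneous e) (hp0 : p ≠ 0) (h : (p * q).IsHomogeneous (e + d)) :
    q.IsHomogeneous d := by
  let := MvPolynomial.gradedAlgebra (σ := ι) (R := R)
  have hpq := DirectSum.coe_decompose_mul_add_of_left_mem (homogeneousSubmodule ι R)
    (i := e) (j := d) (b := q) ((mem_homogeneousSubmodule _ _).2 hp)
  rw [DirectSum.decompose_of_mem_same _ ((mem_homogeneousSubmodule _ _).2 h)] at hpq
  rw [mul_left_cancel₀ hp0 hpq]
  exact (mem_homogeneousSubmodule _ _).1 (SetLike.coe_mem _)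

theorem isHomogeneous_x_sub_t (i j : ℕ) : (x i - t j).IsHomogeneous 1 :=
  (isHomogeneous_X _ _).sub (isHomogeneous_X _ _)

theorem isHomogeneous_map_of_x_t {κ : Type*} {φ : PolTX →ₐ[ℤ] MvPolynomial κ ℤ}
    (hx : ∀ j, (φ (x j)).IsHomogeneous 1) (ht : ∀ j, (φ (t j)).IsHomogeneous 1) {f : PolTX} {d : ℕ}
    (hf : f.IsHomogeneous d) : (φ f).IsHomogeneous d := by
  rw [aeval_unique φ, ← one_mul d]
  exact hf.aeval _ (Sum.forall.2 ⟨hx, ht⟩)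

variable {f : PolTX} {d : ℕ}

theorem isHomogeneous_insertDiff (m a : ℕ) (hf : f.IsHomogeneous d) :
    (insertDiff m a f).IsHomogeneous d := by
  have hx (p j : ℕ) : (insertT p a (x j)).IsHomogeneous 1 := by
    rw [insertT_x]
    split_ifs <;> exact isHomogeneous_X _ _
  have ht (p j : ℕ) : (insertT p a (t j)).IsHomogeneous 1 := by
    rw [insertT_t]
    exact isHomogeneous_X _ _
  exact (isHomogeneous_map_of_x_t (hx _) (ht _) hf).sub (isHomogeneous_map_of_x_t (hx _) (ht _) hf)

theorem isHomogeneous_equivariantTrim (i : ℕ) (hf : f.IsHomogeneous (d + 1)) :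
    (equivariantTrim i f).IsHomogeneous d := by
  refine isHomogeneous_of_mul_left (isHomogeneous_x_sub_t i i) (x_sub_t_ne_zero i i) ?_
  rw [sub_mul_equivariantTrim, add_comm 1 d]
  exact isHomogeneous_insertDiff i i hf

theorem isHomogeneous_ev (σ : Equiv.Perm ℕ) (hf : f.IsHomogeneous d) :
    (ev σ f).IsHomogeneous d :=
  isHomogeneous_map_of_x_t (fun j => by rw [ev_x]; exact isHomogeneous_X _ _)
    (fun j => by rw [ev_t]; exact isHomogeneous_X _ _) hf

end Homogeneity

/-! ### Polynomials with prescribed trimmings -/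

section Integration

variable {g : ℕ → PolTX} {N d : ℕ}

theorem TrimCompatible.exists_equivariantTrim_eq_of_le (hg : TrimCompatible g)
    (hN : ∀ i, N ≤ i → g i = 0) (hd : ∀ i, (g i).IsHomogeneous d) {k : ℕ} (hk : k ≤ N) :
    ∃ f : PolTX, f.IsHomogeneous (d + 1) ∧ ∀ i, k ≤ i → equivariantTrim i f = g i := by
  induction hk using Nat.decreasingInduction with
  | self =>
    exact ⟨0, isHomogeneous_zero _ _ _, fun i hi => by
      rw [hN i hi, equivariantTrim_eq_iff, map_zero, mul_zero]⟩
  | of_succ k _ ih =>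
    obtain ⟨f, hfd, hf⟩ := ih
    -- The error `g k - E_k f` involves no `x_j` with `j > k`, so multiplying it by `x_k - t_k`
    -- gives a correction term that `E_i` annihilates for all `i > k`.
    have hmem : g k - equivariantTrim k f ∈ firstVars (k + 1) :=
      mem_firstVars_of_forall_insertDiff_eq_zero (· + 1) fun m hm => by
        simp only [map_sub, hg k m hm, trimCompatible_equivariantTrim f k m hm,
          hf (m + 1) (by omega), sub_self]
    refine ⟨f + (x k - t k) * (g k - equivariantTrim k f), hfd.add ?_, fun i hi => ?_⟩
    · rw [add_comm d 1]
      exact (isHomogeneous_x_sub_t k k).mul ((hd k).sub (isHomogeneous_equivariantTrim k hfd))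
    · rw [equivariantTrim_add]
      rcases hi.eq_or_lt with rfl | hi
      · rw [equivariantTrim_sub_mul hmem, add_sub_cancel]
      · rw [hf i hi, equivariantTrim_of_mem_firstVars hi, add_zero]
        exact mul_mem (sub_mem (x_mem_firstVars (Nat.lt_succ_self k)) (t_mem_firstVars _ _)) hmem

theorem TrimCompatible.exists_equivariantTrim_eq (hg : TrimCompatible g)
    (hN : ∀ i, N ≤ i → g i = 0) (hd : ∀ i, (g i).IsHomogeneous d) :
    ∃ f : PolTX, f.IsHomogeneous (d + 1) ∧ ev 1 f = 0 ∧ ∀ i, equivariantTrim i f = g i := by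
  obtain ⟨f, hfd, hf⟩ := hg.exists_equivariantTrim_eq_of_le hN hd (Nat.zero_le N)
  refine ⟨f - rename Sum.inr (ev 1 f), hfd.sub ((isHomogeneous_ev 1 hfd).rename_isHomogeneous), ?_,
    fun i => ?_⟩
  · rw [map_sub, ev_rename_inr, sub_self]
  · rw [equivariantTrim_sub, hf i (Nat.zero_le i),
      equivariantTrim_of_mem_firstVars (Nat.zero_le i) (rename_inr_mem_firstVars_zero _), sub_zero]

end Integration

/-! ### Omitting one of the parameters -/

section OmitT

/-- The increasing enumeration of `ℕ \ {i}`. -/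
def skip (i k : ℕ) : ℕ := if k < i then k else k + 1

theorem skip_of_lt {i k : ℕ} (h : k < i) : skip i k = k := if_pos h

theorem skip_of_le {i k : ℕ} (h : i ≤ k) : skip i k = k + 1 := if_neg h.not_gt

@[simp] theorem omitT_x (i j : ℕ) : omitT i (x j) = x j := by
  simp [omitT, x]

theorem omitT_t (i j : ℕ) : omitT i (t j) = t (skip i j) := by
  simp only [omitT, t, aeval_X, Sum.elim_inr, skip]
  split_ifs <;> rfl

theorem isHomogeneous_omitT (i : ℕ) {f : PolTX} {d : ℕ} (hf : f.IsHomogeneous d) :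
    (omitT i f).IsHomogeneous d :=
  isHomogeneous_map_of_x_t (fun j => by rw [omitT_x]; exact isHomogeneous_X _ _)
    (fun j => by rw [omitT_t]; exact isHomogeneous_X _ _) hf

theorem omitT_omitT {i m : ℕ} (h : i ≤ m) (f : PolTX) :
    omitT (m + 1) (omitT i f) = omitT i (omitT m f) := by
  have hcomp : (omitT (m + 1)).comp (omitT i) = (omitT i).comp (omitT m) := by
    refine algHom_ext_x_t (by simp) fun j => ?_
    simp only [AlgHom.comp_apply, omitT_t]
    congr 1
    unfold skip
    split_ifs <;> omega
  exact DFunLike.congr_fun hcomp f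

theorem insertT_omitT (p i a : ℕ) (f : PolTX) :
    insertT p (skip i a) (omitT i f) = omitT i (insertT p a f) := by
  have hcomp : (insertT p (skip i a)).comp (omitT i) = (omitT i).comp (insertT p a) := by
    refine algHom_ext_x_t (fun j => ?_) fun j => by simp [omitT_t]
    simp only [AlgHom.comp_apply, omitT_x, insertT_x]
    split_ifs <;> simp [omitT_t]
  exact DFunLike.congr_fun hcomp f

theorem insertDiff_omitT (m i a : ℕ) (f : PolTX) :
    insertDiff m (skip i a) (omitT i f) = omitT i (insertDiff m a f) := by
  rw [insertDiff_apply, insertDiff_apply, insertT_omitT, insertT_omitT, map_sub]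

theorem insertDiff_skip_omitT (i m : ℕ) (f : PolTX) :
    insertDiff m (skip i m) (omitT i f) = (x m - t (skip i m)) * omitT i (equivariantTrim m f) := by
  rw [insertDiff_omitT, ← sub_mul_equivariantTrim, map_mul, map_sub, omitT_x, omitT_t]

theorem equivariantTrim_omitT {i j : ℕ} (h : i < j) (f : PolTX) :
    equivariantTrim i (omitT j f) = omitT j (equivariantTrim i f) := by
  rw [equivariantTrim_eq_iff]
  simpa only [skip_of_lt h] using insertDiff_skip_omitT j i f

theorem insertDiff_succ_omitT {i m : ℕ} (h : i ≤ m) (f : PolTX) :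
    insertDiff m (m + 1) (omitT i f) = (x m - t (m + 1)) * omitT i (equivariantTrim m f) := by
  simpa only [skip_of_le h] using insertDiff_skip_omitT i m f

end OmitT

/-! ### Grafting a terminal node on a leaf of a tree -/

section Tree

theorem numLeaves_nil : (BinaryTree.nil : BinaryTree Unit).numLeaves = 1 := rfl

theorem numLeaves_node (l r : BinaryTree Unit) :
    (BinaryTree.node () l r).numLeaves = l.numLeaves + r.numLeaves := rfl

/-- For a tree with leaves `k, k + 1, …`, replace the leaf `i` by a terminal node, if there is such
a leaf. This is the inverse operation of `trimTree`. -/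
def graftTree (i : ℕ) : BinaryTree Unit → ℕ → BinaryTree Unit
  | .nil, k => if i = k then .node () .nil .nil else .nil
  | .node _ l r, k => .node () (graftTree i l k) (graftTree i r (k + l.numLeaves))

variable {T : BinaryTree Unit} {i k : ℕ}

theorem graftTree_nil_self (k : ℕ) : graftTree k .nil k = .node () .nil .nil := if_pos rfl

theorem graftTree_of_lt_or_le (h : i < k ∨ k + T.numLeaves ≤ i) : graftTree i T k = T := by
  induction T generalizing k with
  | nil => exact if_neg (by rw [numLeaves_nil] at h; omega)
  | node _ l r ihl ihr =>
    rw [numLeaves_node] at h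
    rw [graftTree, ihl (by omega), ihr (by omega)]

theorem graftTree_node_of_lt {l : BinaryTree Unit} (h : i < k + l.numLeaves) (r : BinaryTree Unit) :
    graftTree i (.node () l r) k = .node () (graftTree i l k) r := by
  rw [graftTree, graftTree_of_lt_or_le (T := r) (.inl h)]

theorem graftTree_node_of_le {l : BinaryTree Unit} (h : k + l.numLeaves ≤ i) (r : BinaryTree Unit) :
    graftTree i (.node () l r) k = .node () l (graftTree i r (k + l.numLeaves)) := by
  rw [graftTree, graftTree_of_lt_or_le (T := l) (.inr h)]

theorem numLeaves_graftTree (hi : k ≤ i) (hi' : i < k + T.numLeaves) :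
    (graftTree i T k).numLeaves = T.numLeaves + 1 := by
  induction T generalizing k with
  | nil =>
    obtain rfl : i = k := by rw [numLeaves_nil] at hi'; omega
    rw [graftTree_nil_self, numLeaves_node, numLeaves_nil]
  | node _ l r ihl ihr =>
    rw [numLeaves_node] at hi' ⊢
    rcases lt_or_ge i (k + l.numLeaves) with h | h
    · rw [graftTree_node_of_lt h, numLeaves_node, ihl hi h, Nat.add_right_comm]
    · rw [graftTree_node_of_le h, numLeaves_node, ihr h (by omega), Nat.add_assoc]

theorem graftTree_ne_nil (hi : k ≤ i) (hi' : i < k + T.numLeaves) : graftTree i T k ≠ .nil := by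
  intro h
  have := numLeaves_graftTree hi hi'
  rw [h, numLeaves_nil] at this
  have := T.numLeaves_pos
  omega

theorem graftTree_succ_succ (i : ℕ) (T : BinaryTree Unit) (k : ℕ) :
    graftTree (i + 1) T (k + 1) = graftTree i T k := by
  induction T generalizing k with
  | nil => simp only [graftTree, Nat.add_right_cancel_iff]
  | node _ l r ihl ihr => rw [graftTree, graftTree, ihl, Nat.add_right_comm, ihr]

theorem graftTree_graftTree {a b : ℕ} (hb : k ≤ b) (h : b < a) (T : BinaryTree Unit) :
    graftTree b (graftTree a T k) k = graftTree (a + 1) (graftTree b T k) k := by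
  induction T generalizing k with
  | nil =>
    have ha : graftTree a .nil k = .nil := if_neg (by omega)
    rw [ha, graftTree_of_lt_or_le (i := a + 1) (.inr _)]
    unfold graftTree
    split_ifs
    · rw [numLeaves_node, numLeaves_nil]; omega
    · rw [numLeaves_nil]; omega
  | node _ l r ihl ihr =>
    rcases lt_or_ge a (k + l.numLeaves) with ha | ha
    · have hla := numLeaves_graftTree (hb.trans h.le) ha
      have hlb := numLeaves_graftTree hb (h.trans ha)
      rw [graftTree_node_of_lt ha, graftTree_node_of_lt (by omega),
        graftTree_node_of_lt (h.trans ha), graftTree_node_of_lt (by omega), ihl hb]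
    rcases lt_or_ge b (k + l.numLeaves) with hb' | hb'
    · have hlb := numLeaves_graftTree hb hb'
      rw [graftTree_node_of_le ha, graftTree_node_of_lt hb', graftTree_node_of_lt hb',
        graftTree_node_of_le (by omega), hlb, ← Nat.add_assoc, graftTree_succ_succ]
    · rw [graftTree_node_of_le ha, graftTree_node_of_le hb', graftTree_node_of_le hb',
        graftTree_node_of_le (by omega), ihr hb']

/-! ### Terminal nodes and trimming of trees -/

theorem mem_terminalLabels_node {l r : BinaryTree Unit} :
    i ∈ terminalLabels (.node () l r) k ↔ (l = .nil ∧ r = .nil ∧ i = k) ∨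
      i ∈ terminalLabels l k ∨ i ∈ terminalLabels r (k + l.numLeaves) := by
  simp [terminalLabels, or_assoc]

theorem ne_nil_of_mem_terminalLabels (h : i ∈ terminalLabels T k) : T ≠ .nil := by
  rintro rfl
  exact h

theorem bounds_of_mem_terminalLabels (h : i ∈ terminalLabels T k) :
    k ≤ i ∧ i + 1 < k + T.numLeaves := by
  induction T generalizing k with
  | nil => exact h.elim
  | node _ l r ihl ihr =>
    have hl := l.numLeaves_pos
    have hr := r.numLeaves_pos
    rw [numLeaves_node]
    rcases mem_terminalLabels_node.1 h with ⟨_, _, rfl⟩ | h | h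
    · omega
    · have := ihl h; omega
    · have := ihr h; omega

theorem exists_mem_terminalLabels (h : T ≠ .nil) (k : ℕ) : ∃ i, i ∈ terminalLabels T k := by
  induction T generalizing k with
  | nil => exact absurd rfl h
  | node _ l r ihl ihr =>
    by_cases hl : l = .nil
    · by_cases hr : r = .nil
      · exact ⟨k, mem_terminalLabels_node.2 (.inl ⟨hl, hr, rfl⟩)⟩
      · obtain ⟨i, hi⟩ := ihr hr (k + l.numLeaves)
        exact ⟨i, mem_terminalLabels_node.2 (.inr (.inr hi))⟩
    · obtain ⟨i, hi⟩ := ihl hl k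
      exact ⟨i, mem_terminalLabels_node.2 (.inr (.inl hi))⟩

theorem mem_terminalLabels_graftTree (hi : k ≤ i) (hi' : i < k + T.numLeaves) :
    i ∈ terminalLabels (graftTree i T k) k := by
  induction T generalizing k with
  | nil =>
    obtain rfl : i = k := by rw [numLeaves_nil] at hi'; omega
    rw [graftTree_nil_self]
    exact mem_terminalLabels_node.2 (.inl ⟨rfl, rfl, rfl⟩)
  | node _ l r ihl ihr =>
    rw [numLeaves_node] at hi'
    rcases lt_or_ge i (k + l.numLeaves) with h | h
    · rw [graftTree_node_of_lt h]
      exact mem_terminalLabels_node.2 (.inr (.inl (ihl hi h)))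
    · rw [graftTree_node_of_le h]
      exact mem_terminalLabels_node.2 (.inr (.inr (ihr h (by omega))))

theorem trimTree_of_notMem (h : i ∉ terminalLabels T k) : trimTree i T k = T := by
  induction T generalizing k with
  | nil => rfl
  | node _ l r ihl ihr =>
    rw [mem_terminalLabels_node, not_or, not_or] at h
    rw [trimTree, if_neg h.1, ihl h.2.1, ihr h.2.2]

theorem trimTree_of_lt_or_le (h : i < k ∨ k + T.numLeaves ≤ i + 1) : trimTree i T k = T :=
  trimTree_of_notMem fun hi => by have := bounds_of_mem_terminalLabels hi; omega

theorem trimTree_node_of_lt {l r : BinaryTree Unit} (hl : l ≠ .nil) (h : i < k + l.numLeaves) :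
    trimTree i (.node () l r) k = .node () (trimTree i l k) r := by
  rw [trimTree, if_neg fun h' => hl h'.1, trimTree_of_lt_or_le (T := r) (.inl h)]

theorem trimTree_node_of_le {l r : BinaryTree Unit} (hr : r ≠ .nil)
    (h : k + l.numLeaves ≤ i + 1) :
    trimTree i (.node () l r) k = .node () l (trimTree i r (k + l.numLeaves)) := by
  rw [trimTree, if_neg fun h' => hr h'.2.1, trimTree_of_lt_or_le (T := l) (.inr h)]

theorem trimTree_graftTree (hi : k ≤ i) (hi' : i < k + T.numLeaves) :
    trimTree i (graftTree i T k) k = T := by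
  induction T generalizing k with
  | nil =>
    obtain rfl : i = k := by rw [numLeaves_nil] at hi'; omega
    rw [graftTree_nil_self, trimTree, if_pos ⟨rfl, rfl, rfl⟩]
  | node _ l r ihl ihr =>
    rw [numLeaves_node] at hi'
    rcases lt_or_ge i (k + l.numLeaves) with h | h
    · have := numLeaves_graftTree hi h
      rw [graftTree_node_of_lt h, trimTree_node_of_lt (graftTree_ne_nil hi h) (by omega), ihl hi h]
    · have h' : i < k + l.numLeaves + r.numLeaves := by omega
      rw [graftTree_node_of_le h, trimTree_node_of_le (graftTree_ne_nil h h') (by omega), ihr h h']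

theorem numLeaves_trimTree_and_graftTree_trimTree (h : i ∈ terminalLabels T k) :
    (trimTree i T k).numLeaves + 1 = T.numLeaves ∧ graftTree i (trimTree i T k) k = T := by
  induction T generalizing k with
  | nil => exact h.elim
  | node _ l r ihl ihr =>
    rcases mem_terminalLabels_node.1 h with ⟨rfl, rfl, rfl⟩ | h | h
    · rw [trimTree, if_pos ⟨rfl, rfl, rfl⟩, graftTree_nil_self]
      exact ⟨rfl, rfl⟩
    · have hb := bounds_of_mem_terminalLabels h
      obtain ⟨hn, hg⟩ := ihl h
      rw [trimTree_node_of_lt (ne_nil_of_mem_terminalLabels h) (by omega), numLeaves_node,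
        numLeaves_node, graftTree_node_of_lt (by omega), hg]
      exact ⟨by omega, rfl⟩
    · have hb := bounds_of_mem_terminalLabels h
      obtain ⟨hn, hg⟩ := ihr h
      rw [trimTree_node_of_le (ne_nil_of_mem_terminalLabels h) (by omega), numLeaves_node,
        numLeaves_node, graftTree_node_of_le hb.1, hg]
      exact ⟨by omega, rfl⟩

theorem graftTree_trimTree (h : i ∈ terminalLabels T k) : graftTree i (trimTree i T k) k = T :=
  (numLeaves_trimTree_and_graftTree_trimTree h).2

theorem numLeaves_trimTree (h : i ∈ terminalLabels T k) :
    (trimTree i T k).numLeaves + 1 = T.numLeaves :=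
  (numLeaves_trimTree_and_graftTree_trimTree h).1

end Tree

/-! ### Grafting and trimming of indexed forests -/

namespace IndexedForest

theorem ext_tree {F G : IndexedForest} (h : ∀ j, F.tree j = G.tree j) : F = G := by
  cases F; cases G
  congr
  exact funext h

@[simp] theorem start_zero (F : IndexedForest) : F.start 0 = 0 := Finset.sum_range_zero _

theorem start_succ (F : IndexedForest) (j : ℕ) :
    F.start (j + 1) = F.start j + (F.tree j).numLeaves := Finset.sum_range_succ _ _

theorem start_strictMono (F : IndexedForest) : StrictMono F.start :=
  strictMono_nat_of_lt_succ fun j => by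
    rw [start_succ]
    exact Nat.lt_add_of_pos_right (BinaryTree.numLeaves_pos _)

theorem le_start (F : IndexedForest) (j : ℕ) : j ≤ F.start j := F.start_strictMono.le_apply

theorem exists_start_le_lt (F : IndexedForest) (i : ℕ) :
    ∃ j, F.start j ≤ i ∧ i < F.start (j + 1) := by
  have h : ∃ j, i < F.start (j + 1) := ⟨i, F.le_start (i + 1)⟩
  refine ⟨Nat.find h, ?_, Nat.find_spec h⟩
  rcases hj : Nat.find h with _ | j
  · simp
  · exact not_lt.1 (Nat.find_min h (hj ▸ Nat.lt_succ_self j))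

/-- Replace the leaf `i` of a forest by a terminal node. This is the inverse operation
of `IndexedForest.trim`. -/
def graft (F : IndexedForest) (i : ℕ) : IndexedForest where
  tree j := graftTree i (F.tree j) (F.start j)
  finite_nontrivial := by
    refine (F.finite_nontrivial.union (Set.finite_Iic i)).subset fun j hj => ?_
    rcases lt_or_ge i (F.start j) with h | h
    · exact .inl (by rwa [Set.mem_ofPred_eq, graftTree_of_lt_or_le (.inl h)] at hj)
    · exact .inr ((F.le_start j).trans h)

variable {F : IndexedForest} {i j : ℕ}

theorem tree_graft (F : IndexedForest) (i j : ℕ) :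
    (F.graft i).tree j = graftTree i (F.tree j) (F.start j) := rfl

theorem tree_trim (F : IndexedForest) (i j : ℕ) :
    (F.trim i).tree j = trimTree i (F.tree j) (F.start j) := rfl

theorem tree_graft_of_start_succ_le (h : F.start (j + 1) ≤ i) : (F.graft i).tree j = F.tree j :=
  graftTree_of_lt_or_le (.inr (by rwa [← start_succ]))

theorem tree_graft_of_lt_start (h : i < F.start j) : (F.graft i).tree j = F.tree j :=
  graftTree_of_lt_or_le (.inl h)

theorem tree_graft_ne_nil_iff :
    (F.graft i).tree j ≠ .nil ↔ F.tree j ≠ .nil ∨ (F.start j ≤ i ∧ i < F.start (j + 1)) := by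
  rcases lt_or_ge i (F.start j) with h | h
  · simp [tree_graft_of_lt_start h, h.not_ge]
  rcases lt_or_ge i (F.start (j + 1)) with h' | h'
  · exact iff_of_true (graftTree_ne_nil h (by rwa [← start_succ])) (.inr ⟨h, h'⟩)
  · simp [tree_graft_of_start_succ_le h', h'.not_gt]

theorem start_graft (F : IndexedForest) (i j : ℕ) :
    (F.graft i).start j = F.start j + if i < F.start j then 1 else 0 := by
  induction j with
  | zero => simp
  | succ j ih =>
    have hs := F.start_succ j
    rw [start_succ, ih]
    rcases lt_or_ge i (F.start j) with h | h
    · rw [tree_graft_of_lt_start h, if_pos h, if_pos (by omega)]; omega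
    · rw [if_neg (by omega)]
      rcases lt_or_ge i (F.start (j + 1)) with h' | h'
      · rw [tree_graft, if_pos h', numLeaves_graftTree h (by omega)]; omega
      · rw [tree_graft_of_start_succ_le h', if_neg (by omega)]; omega

theorem start_graft_of_lt (h : i < F.start j) : (F.graft i).start j = F.start j + 1 := by
  rw [start_graft, if_pos h]

theorem start_graft_of_le (h : F.start j ≤ i) : (F.graft i).start j = F.start j := by
  rw [start_graft, if_neg h.not_gt, add_zero]

theorem graft_graft (F : IndexedForest) {a b : ℕ} (h : b < a) :
    (F.graft a).graft b = (F.graft b).graft (a + 1) := by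
  refine ext_tree fun j => ?_
  rcases lt_or_ge b (F.start j) with hb | hb
  · have : F.start j ≤ (F.graft a).start j := by rw [start_graft]; omega
    rw [tree_graft_of_lt_start (by omega), tree_graft, tree_graft _ (a + 1),
      tree_graft_of_lt_start hb, start_graft_of_lt hb, graftTree_succ_succ]
  · rw [tree_graft, tree_graft, tree_graft, tree_graft, start_graft_of_le (by omega),
      start_graft_of_le hb, graftTree_graftTree hb h]

theorem mem_qDes_graft (F : IndexedForest) (i : ℕ) : i ∈ (F.graft i).qDes := by
  obtain ⟨j, hj, hj'⟩ := F.exists_start_le_lt i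
  refine ⟨j, ?_⟩
  rw [start_graft_of_le hj]
  exact mem_terminalLabels_graftTree hj (by rwa [← start_succ])

theorem trim_graft (F : IndexedForest) (i : ℕ) : (F.graft i).trim i = F := by
  refine ext_tree fun j => ?_
  have hs := F.start_succ j
  rw [tree_trim]
  rcases lt_or_ge i (F.start j) with h | h
  · rw [tree_graft_of_lt_start h, start_graft_of_lt h, trimTree_of_lt_or_le (.inl (by omega))]
  · rw [start_graft_of_le h]
    rcases lt_or_ge i (F.start (j + 1)) with h' | h'
    · exact trimTree_graftTree h (by omega)
    · rw [tree_graft_of_start_succ_le h', trimTree_of_lt_or_le (.inr (by omega))]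

theorem mem_terminalLabels_of_mem_qDes (hi : i ∈ F.qDes) (h : F.start j ≤ i)
    (h' : i < F.start (j + 1)) : i ∈ terminalLabels (F.tree j) (F.start j) := by
  obtain ⟨j₀, h₀⟩ := hi
  have hb := bounds_of_mem_terminalLabels h₀
  rw [← start_succ] at hb
  have h1 : j₀ < j + 1 := F.start_strictMono.lt_iff_lt.1 (by omega)
  have h2 : j < j₀ + 1 := F.start_strictMono.lt_iff_lt.1 (by omega)
  obtain rfl : j₀ = j := by omega
  exact h₀

theorem start_trim (hi : i ∈ F.qDes) (j : ℕ) :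
    (F.trim i).start j + (if i < F.start j then 1 else 0) = F.start j := by
  induction j with
  | zero => simp
  | succ j ih =>
    have hs := F.start_succ j
    rw [start_succ, tree_trim]
    rcases lt_or_ge i (F.start j) with h | h
    · rw [if_pos h] at ih
      rw [if_pos (by omega), trimTree_of_lt_or_le (.inl h)]; omega
    · rw [if_neg (by omega)] at ih
      rcases lt_or_ge i (F.start (j + 1)) with h' | h'
      · have := numLeaves_trimTree (mem_terminalLabels_of_mem_qDes hi h h')
        rw [if_pos h']; omega
      · rw [if_neg (by omega), trimTree_of_lt_or_le (.inr (by omega))]; omega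

theorem graft_trim (hi : i ∈ F.qDes) : (F.trim i).graft i = F := by
  refine ext_tree fun j => ?_
  have hs := F.start_succ j
  have ht := start_trim hi j
  rw [tree_graft, tree_trim]
  rcases lt_or_ge i (F.start j) with h | h
  · rw [if_pos h] at ht
    rw [trimTree_of_lt_or_le (.inl h)]
    obtain ⟨j₀, h₀⟩ := hi
    have hb := bounds_of_mem_terminalLabels h₀
    rw [← start_succ] at hb
    have h1 : F.start (j₀ + 1) ≤ F.start j :=
      F.start_strictMono.monotone (F.start_strictMono.lt_iff_lt.1 (hb.1.trans_lt h))
    exact graftTree_of_lt_or_le (.inl (by omega))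
  · rw [if_neg h.not_gt, add_zero] at ht
    rw [ht]
    rcases lt_or_ge i (F.start (j + 1)) with h' | h'
    · exact graftTree_trimTree (mem_terminalLabels_of_mem_qDes hi h h')
    · rw [trimTree_of_lt_or_le (.inr (by omega)), graftTree_of_lt_or_le (.inr (by omega))]

theorem qDes_trim_comm {m : ℕ} (h : i < m) :
    (m + 1 ∈ F.qDes ∧ i ∈ (F.trim (m + 1)).qDes) ↔ (i ∈ F.qDes ∧ m ∈ (F.trim i).qDes) := by
  constructor
  · rintro ⟨h1, h2⟩
    have hF : F = (((F.trim (m + 1)).trim i).graft m).graft i := by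
      rw [graft_graft _ h, graft_trim h2, graft_trim h1]
    rw [hF, trim_graft]
    exact ⟨mem_qDes_graft _ _, mem_qDes_graft _ _⟩
  · rintro ⟨h1, h2⟩
    have hF : F = (((F.trim i).trim m).graft i).graft (m + 1) := by
      rw [← graft_graft _ h, graft_trim h2, graft_trim h1]
    rw [hF, trim_graft]
    exact ⟨mem_qDes_graft _ _, mem_qDes_graft _ _⟩

theorem trim_trim_comm {m : ℕ} (h : i < m) (h1 : i ∈ F.qDes) (h2 : m ∈ (F.trim i).qDes) :
    (F.trim (m + 1)).trim i = (F.trim i).trim m := by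
  have hF : F = (((F.trim i).trim m).graft i).graft (m + 1) := by
    rw [← graft_graft _ h, graft_trim h2, graft_trim h1]
  conv_lhs => rw [hF, trim_graft, trim_graft]

theorem exists_mem_qDes (h : F ≠ empty) : ∃ i, i ∈ F.qDes := by
  by_contra! hne
  refine h (ext_tree fun j => ?_)
  by_contra hj
  obtain ⟨i, hi⟩ := exists_mem_terminalLabels hj (F.start j)
  exact hne i ⟨j, hi⟩

theorem notMem_qDes_empty (i : ℕ) : i ∉ empty.qDes := fun ⟨_, h⟩ => h

/-! ### The number of internal nodes of a forest -/

theorem exists_forall_tree_eq_nil (F : IndexedForest) : ∃ N, ∀ j, N ≤ j → F.tree j = .nil := by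
  obtain ⟨N, hN⟩ := F.finite_nontrivial.bddAbove
  refine ⟨N + 1, fun j hj => ?_⟩
  by_contra h
  exact (hN h).not_gt hj

theorem exists_qDes_lt (F : IndexedForest) : ∃ N, ∀ i ∈ F.qDes, i < N := by
  obtain ⟨N, hN⟩ := F.exists_forall_tree_eq_nil
  refine ⟨F.start N, ?_⟩
  rintro i ⟨j, hj⟩
  have hjN : j < N := by
    by_contra! h
    exact ne_nil_of_mem_terminalLabels hj (hN j h)
  have hb := bounds_of_mem_terminalLabels hj
  rw [← start_succ] at hb
  have : F.start (j + 1) ≤ F.start N := F.start_strictMono.monotone hjN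
  omega

/-- The number of internal nodes of a forest, which is the degree of its double forest
polynomial. -/
noncomputable def size (F : IndexedForest) : ℕ := ∑ᶠ j, (F.tree j).numNodes

theorem start_eq_add_size {N : ℕ} (h : ∀ j, N ≤ j → F.tree j = .nil) :
    F.start N = N + F.size := by
  have hsupp : (fun j => (F.tree j).numNodes).support ⊆ Finset.range N := fun j hj => by
    rw [Finset.coe_range, Set.mem_Iio]
    by_contra! hj'
    exact hj (by simp [h j hj', BinaryTree.numNodes])
  rw [size, finsum_eq_sum_of_support_subset _ hsupp]
  simp [start, BinaryTree.numLeaves_eq_numNodes_succ, Finset.sum_add_distrib, add_comm]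

theorem size_empty : size empty = 0 := finsum_zero

theorem size_graft (F : IndexedForest) (i : ℕ) : (F.graft i).size = F.size + 1 := by
  obtain ⟨N, hN⟩ := F.exists_forall_tree_eq_nil
  obtain ⟨M, hM⟩ := (F.graft i).exists_forall_tree_eq_nil
  have h1 := start_eq_add_size (N := N + M + i + 1) fun j hj => hN j (by omega)
  have h2 := start_eq_add_size (N := N + M + i + 1) fun j hj => hM j (by omega)
  rw [start_graft_of_lt (by omega)] at h2
  omega

theorem size_trim (h : i ∈ F.qDes) : (F.trim i).size + 1 = F.size := by
  rw [← size_graft, graft_trim h]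

theorem graft_induction {motive : IndexedForest → Prop} (empty : motive empty)
    (graft : ∀ F i, motive F → motive (F.graft i)) (F : IndexedForest) : motive F := by
  induction hs : F.size using Nat.strong_induction_on generalizing F with
  | _ s ih =>
  by_cases hF : F = .empty
  · rwa [hF]
  · obtain ⟨i, hi⟩ := exists_mem_qDes hF
    have := size_trim hi
    rw [← graft_trim hi]
    exact graft _ _ (ih _ (by omega) _ rfl)

end IndexedForest

/-! ### Forests supported on an initial segment -/

section ForestsOn

variable {n i : ℕ} {F : IndexedForest}

theorem mem_forestsOn_iff : F ∈ forestsOn n ↔ ∀ j, F.tree j ≠ .nil → F.start (j + 1) ≤ n := by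
  constructor
  · intro h j hj
    have hs := F.start_succ j
    have hpos := (F.tree j).numLeaves_pos
    have hlast : F.start (j + 1) - 1 < n := h ⟨j, hj, by omega, by omega⟩
    omega
  · rintro h k ⟨j, hj, -, hk⟩
    exact (hk.trans_eq (F.start_succ j).symm).trans_le (h j hj)

theorem empty_mem_forestsOn (n : ℕ) : IndexedForest.empty ∈ forestsOn n :=
  mem_forestsOn_iff.2 fun _ h => absurd rfl h

theorem graft_mem_forestsOn_iff : F.graft i ∈ forestsOn (n + 1) ↔ F ∈ forestsOn n ∧ i < n := by
  simp only [mem_forestsOn_iff, IndexedForest.tree_graft_ne_nil_iff, IndexedForest.start_graft]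
  constructor
  · intro h
    obtain ⟨j₀, hj₀⟩ := F.exists_start_le_lt i
    have hi := h j₀ (.inr hj₀)
    rw [if_pos hj₀.2] at hi
    refine ⟨fun j hj => ?_, by omega⟩
    have := h j (.inl hj)
    split_ifs at this <;> omega
  · rintro ⟨hF, hi⟩ j hj
    have hle : F.start (j + 1) ≤ n := by
      by_cases hnil : F.tree j = .nil
      · have hs := F.start_succ j
        rw [hnil, numLeaves_nil] at hs
        have := (hj.resolve_left (not_not.2 hnil)).1
        omega
      · exact hF j hnil
    split_ifs <;> omega

end ForestsOn

/-! ### Existence and uniqueness of the double forest polynomials -/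

section Existence

open Classical in
/-- The polynomials that `E_0 (P F), E_1 (P F), …` have to be if `P` is the family of double
forest polynomials. -/
noncomputable def prescribedTrim (P : IndexedForest → PolTX) (F : IndexedForest) (i : ℕ) : PolTX :=
  if i ∈ F.qDes then omitT i (P (F.trim i)) else 0

variable {P : IndexedForest → PolTX} {F : IndexedForest} {i : ℕ}

theorem prescribedTrim_of_mem (h : i ∈ F.qDes) : prescribedTrim P F i = omitT i (P (F.trim i)) :=
  if_pos h

theorem prescribedTrim_of_notMem (h : i ∉ F.qDes) : prescribedTrim P F i = 0 := if_neg h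

theorem equivariantTrim_zero (i : ℕ) : equivariantTrim i 0 = 0 :=
  equivariantTrim_of_mem_firstVars (Nat.zero_le i) (zero_mem _)

theorem trimCompatible_prescribedTrim
    (h : ∀ i ∈ F.qDes, ∀ m, equivariantTrim m (P (F.trim i)) = prescribedTrim P (F.trim i) m) :
    TrimCompatible (prescribedTrim P F) := by
  intro i m him
  have hcomm := IndexedForest.qDes_trim_comm (F := F) him
  by_cases hi : i ∈ F.qDes ∧ m ∈ (F.trim i).qDes
  · obtain ⟨hm, hmi⟩ := hcomm.2 hi
    rw [prescribedTrim_of_mem hi.1, insertDiff_succ_omitT him.le, h i hi.1,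
      prescribedTrim_of_mem hi.2, prescribedTrim_of_mem hm, equivariantTrim_omitT (by omega),
      h _ hm, prescribedTrim_of_mem hmi, omitT_omitT him.le,
      IndexedForest.trim_trim_comm him hi.1 hi.2]
  · have hleft : insertDiff m (m + 1) (prescribedTrim P F i) = 0 := by
      by_cases h1 : i ∈ F.qDes
      · rw [prescribedTrim_of_mem h1, insertDiff_succ_omitT him.le, h i h1,
          prescribedTrim_of_notMem fun h2 => hi ⟨h1, h2⟩, map_zero, mul_zero]
      · rw [prescribedTrim_of_notMem h1, map_zero]
    have hright : equivariantTrim i (prescribedTrim P F (m + 1)) = 0 := by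
      by_cases h1 : m + 1 ∈ F.qDes
      · rw [prescribedTrim_of_mem h1, equivariantTrim_omitT (by omega), h _ h1,
          prescribedTrim_of_notMem fun h2 => hi (hcomm.1 ⟨h1, h2⟩), map_zero]
      · rw [prescribedTrim_of_notMem h1, equivariantTrim_zero]
    rw [hleft, hright, mul_zero]

open Classical in
/-- A double forest polynomial of `F`, chosen by recursion on the number of internal nodes. -/
noncomputable def forestPolyRec (F : IndexedForest) : PolTX :=
  if F = IndexedForest.empty then 1
  else Classical.epsilon fun f : PolTX => f.IsHomogeneous F.size ∧ ev 1 f = 0 ∧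
    ∀ i, equivariantTrim i f = if _h : i ∈ F.qDes then omitT i (forestPolyRec (F.trim i)) else 0
termination_by F.size
decreasing_by
  have := IndexedForest.size_trim _h
  omega

theorem forestPolyRec_empty : forestPolyRec IndexedForest.empty = 1 := by
  rw [forestPolyRec, if_pos rfl]

theorem forestPolyRec_of_ne_empty (hF : F ≠ IndexedForest.empty) :
    forestPolyRec F = Classical.epsilon fun f : PolTX => f.IsHomogeneous F.size ∧ ev 1 f = 0 ∧
      ∀ i, equivariantTrim i f = prescribedTrim forestPolyRec F i := by
  rw [forestPolyRec, if_neg hF]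
  simp only [dite_eq_ite, prescribedTrim]

open Classical in
theorem forestPolyRec_spec (F : IndexedForest) :
    (forestPolyRec F).IsHomogeneous F.size ∧
      ev 1 (forestPolyRec F) = (if F = IndexedForest.empty then 1 else 0) ∧
      ∀ i, equivariantTrim i (forestPolyRec F) = prescribedTrim forestPolyRec F i := by
  induction hs : F.size using Nat.strong_induction_on generalizing F with
  | _ s ih =>
  by_cases hF : F = IndexedForest.empty
  · subst hF
    rw [forestPolyRec_empty, ← hs, IndexedForest.size_empty, if_pos rfl, map_one]
    refine ⟨isHomogeneous_one _ _, rfl, fun i => ?_⟩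
    rw [prescribedTrim_of_notMem (IndexedForest.notMem_qDes_empty i),
      equivariantTrim_of_mem_firstVars (Nat.zero_le i) (one_mem _)]
  obtain ⟨i₀, hi₀⟩ := IndexedForest.exists_mem_qDes hF
  have ihtrim {i : ℕ} (hi : i ∈ F.qDes) :=
    ih _ (by have := IndexedForest.size_trim hi; omega) (F.trim i) rfl
  have hhom (i : ℕ) : (prescribedTrim forestPolyRec F i).IsHomogeneous (F.trim i₀).size := by
    by_cases hi : i ∈ F.qDes
    · rw [prescribedTrim_of_mem hi,
        Nat.succ_injective ((IndexedForest.size_trim hi₀).trans (IndexedForest.size_trim hi).symm)]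
      exact isHomogeneous_omitT i (ihtrim hi).1
    · rw [prescribedTrim_of_notMem hi]
      exact isHomogeneous_zero _ _ _
  obtain ⟨N, hN⟩ := F.exists_qDes_lt
  have hex := (trimCompatible_prescribedTrim fun i hi => (ihtrim hi).2.2).exists_equivariantTrim_eq
    (N := N) (fun i hi => prescribedTrim_of_notMem fun h => (hN i h).not_ge hi) hhom
  rw [if_neg hF, ← hs]
  rw [IndexedForest.size_trim hi₀] at hex
  rw [forestPolyRec_of_ne_empty hF]
  exact Classical.epsilon_spec hex

theorem isDoubleForestFamily_forestPolyRec : IsDoubleForestFamily forestPolyRec where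
  homogeneous F := ⟨_, (forestPolyRec_spec F).1⟩
  normalized F := (forestPolyRec_spec F).2.1
  trimming F := (forestPolyRec_spec F).2.2

theorem IsDoubleForestFamily.unique {P Q : IndexedForest → PolTX} (hP : IsDoubleForestFamily P)
    (hQ : IsDoubleForestFamily Q) : P = Q := by
  funext F
  induction hs : F.size using Nat.strong_induction_on generalizing F with
  | _ s ih =>
  rw [← sub_eq_zero]
  refine eq_zero_of_forall_equivariantTrim_eq_zero (fun i => ?_) ?_
  · rw [equivariantTrim_sub, hP.trimming, hQ.trimming]
    split_ifs with hi
    · have := IndexedForest.size_trim hi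
      rw [ih _ (by omega) (F.trim i) rfl, sub_self]
    · rw [sub_zero]
  · rw [map_sub, hP.normalized, hQ.normalized, sub_self]

theorem existsUnique_isDoubleForestFamily : ∃! P, IsDoubleForestFamily P :=
  ⟨_, isDoubleForestFamily_forestPolyRec, fun _ hQ => hQ.unique isDoubleForestFamily_forestPolyRec⟩

theorem isDoubleForestFamily_doubleForestPoly : IsDoubleForestFamily doubleForestPoly :=
  Classical.epsilon_spec existsUnique_isDoubleForestFamily.exists

theorem ev_one_doubleForestPoly (F : IndexedForest) [Decidable (F = IndexedForest.empty)] :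
    ev 1 (doubleForestPoly F) = if F = IndexedForest.empty then 1 else 0 := by
  rw [isDoubleForestFamily_doubleForestPoly.normalized]
  congr

theorem equivariantTrim_doubleForestPoly_graft (F : IndexedForest) (i : ℕ) :
    equivariantTrim i (doubleForestPoly (F.graft i)) = omitT i (doubleForestPoly F) := by
  rw [isDoubleForestFamily_doubleForestPoly.trimming, if_pos (F.mem_qDes_graft i), F.trim_graft]

theorem equivariantTrim_doubleForestPoly_of_notMem (h : i ∉ F.qDes) :
    equivariantTrim i (doubleForestPoly F) = 0 := by
  rw [isDoubleForestFamily_doubleForestPoly.trimming, if_neg h]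

end Existence

/-! ### Inserting a fixed point into a permutation -/

section ShiftPerm

variable {i k : ℕ} {σ τ : Equiv.Perm ℕ}

theorem skip_strictMono (i : ℕ) : StrictMono (skip i) := fun a b h => by
  unfold skip; split_ifs <;> omega

theorem skip_ne (i k : ℕ) : skip i k ≠ i := by
  unfold skip; split_ifs <;> omega

theorem skip_lt_self_iff : skip i k < i ↔ k < i := by
  unfold skip; split_ifs <;> omega

theorem le_skip_iff {b : ℕ} : b ≤ skip i k ↔ (if i < b then b - 1 else b) ≤ k := by
  unfold skip; split_ifs <;> omega

theorem eq_or_eq_skip (i k : ℕ) : k = i ∨ ∃ m, k = skip i m := by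
  rcases lt_trichotomy k i with h | h | h
  · exact .inr ⟨k, (skip_of_lt h).symm⟩
  · exact .inl h
  · exact .inr ⟨k - 1, by rw [skip_of_le (by omega)]; omega⟩

/-- The increasing bijection from `ℕ` to `ℕ \ {i}`. -/
noncomputable def skipEquiv (i : ℕ) : ℕ ≃ {k : ℕ // k ≠ i} :=
  Equiv.ofBijective (fun k => ⟨skip i k, skip_ne i k⟩)
    ⟨fun _ _ h => (skip_strictMono i).injective (Subtype.ext_iff.1 h), fun ⟨k, hk⟩ =>
      ((eq_or_eq_skip i k).resolve_left hk).imp fun _ h => Subtype.ext h.symm⟩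

@[simp] theorem coe_skipEquiv (i k : ℕ) : (skipEquiv i k : ℕ) = skip i k := rfl

/-- The permutation that fixes `i` and is given by `σ` on the complement of `i`. -/
noncomputable def shiftPerm (i : ℕ) : Equiv.Perm ℕ →* Equiv.Perm ℕ :=
  Equiv.Perm.extendDomainHom (skipEquiv i)

@[simp] theorem shiftPerm_self (i : ℕ) (σ : Equiv.Perm ℕ) : shiftPerm i σ i = i :=
  Equiv.Perm.extendDomain_apply_not_subtype σ (skipEquiv i) (by simp)

@[simp] theorem shiftPerm_skip (i : ℕ) (σ : Equiv.Perm ℕ) (k : ℕ) :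
    shiftPerm i σ (skip i k) = skip i (σ k) :=
  Equiv.Perm.extendDomain_apply_image σ (skipEquiv i) k

theorem shiftPerm_of_lt (σ : Equiv.Perm ℕ) (h : k < i) : shiftPerm i σ k = skip i (σ k) := by
  rw [← shiftPerm_skip, skip_of_lt h]

theorem shiftPerm_succ_of_le (σ : Equiv.Perm ℕ) (h : i ≤ k) :
    shiftPerm i σ (k + 1) = skip i (σ k) := by
  rw [← skip_of_le h, shiftPerm_skip]

theorem shiftPerm_injective (i : ℕ) : Function.Injective (shiftPerm i) :=
  Equiv.Perm.extendDomainHom_injective (skipEquiv i)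

theorem eq_shiftPerm (h : τ i = i) (h' : ∀ k, τ (skip i k) = skip i (σ k)) :
    τ = shiftPerm i σ := by
  ext k
  rcases eq_or_eq_skip i k with rfl | ⟨m, rfl⟩
  · rw [h, shiftPerm_self]
  · rw [h', shiftPerm_skip]

theorem exists_eq_shiftPerm (h : τ i = i) : ∃ σ, τ = shiftPerm i σ := by
  have hne (k : ℕ) : τ k ≠ i ↔ k ≠ i := by
    simpa only [h] using τ.injective.ne_iff (x := k) (y := i)
  refine ⟨(skipEquiv i).permCongr.symm (τ.subtypePerm hne), eq_shiftPerm h fun k => ?_⟩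
  simp [← coe_skipEquiv]

theorem shiftPerm_swap (i a b : ℕ) :
    shiftPerm i (Equiv.swap a b) = Equiv.swap (skip i a) (skip i b) :=
  (eq_shiftPerm (Equiv.swap_apply_of_ne_of_ne (skip_ne i a).symm (skip_ne i b).symm) fun k =>
    ((skip_strictMono i).injective.map_swap a b k).symm).symm

end ShiftPerm

/-! ### Inserting a descent or an ascent -/

section Insert

variable {i k : ℕ}

@[simp] theorem simpleTransposition_self (i : ℕ) : simpleTransposition i i = i + 1 :=
  Equiv.swap_apply_left _ _

@[simp] theorem simpleTransposition_succ (i : ℕ) : simpleTransposition i (i + 1) = i :=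
  Equiv.swap_apply_right _ _

theorem simpleTransposition_of_ne (h : k ≠ i) (h' : k ≠ i + 1) : simpleTransposition i k = k :=
  Equiv.swap_apply_of_ne_of_ne h h'

@[simp] theorem simpleTransposition_mul_self (i : ℕ) :
    simpleTransposition i * simpleTransposition i = 1 := Equiv.swap_mul_self _ _

/-- Insert the letter `i` next to position `i` of the one-line form of `σ`, on the side that
produces a descent at `i`. This is the effect of grafting on noncrossing permutations. -/
noncomputable def insertDesc (i : ℕ) (σ : Equiv.Perm ℕ) : Equiv.Perm ℕ :=
  if σ i < i then shiftPerm i σ else shiftPerm i σ * simpleTransposition i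

/-- Insert the letter `i` next to position `i` of the one-line form of `σ`, on the side that
produces an ascent at `i`. -/
noncomputable def insertAsc (i : ℕ) (σ : Equiv.Perm ℕ) : Equiv.Perm ℕ :=
  if σ i < i then shiftPerm i σ * simpleTransposition i else shiftPerm i σ

theorem insertAsc_mul (i : ℕ) (σ : Equiv.Perm ℕ) :
    insertAsc i σ * simpleTransposition i = insertDesc i σ := by
  unfold insertAsc insertDesc
  split_ifs <;> simp [mul_assoc]

theorem shiftPerm_mul_simpleTransposition_self (i : ℕ) (σ : Equiv.Perm ℕ) :
    (shiftPerm i σ * simpleTransposition i) i = skip i (σ i) := by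
  simp [shiftPerm_succ_of_le]

theorem shiftPerm_mul_simpleTransposition_succ (i : ℕ) (σ : Equiv.Perm ℕ) :
    (shiftPerm i σ * simpleTransposition i) (i + 1) = i := by
  simp

theorem shiftPerm_mul_simpleTransposition_skip (σ : Equiv.Perm ℕ) (h : k ≠ i) :
    (shiftPerm i σ * simpleTransposition i) (skip i k) = skip i (σ k) := by
  have hne : skip i k ≠ i + 1 := by
    unfold skip; split_ifs <;> omega
  rw [Equiv.Perm.mul_apply, simpleTransposition_of_ne (skip_ne i k) hne, shiftPerm_skip]

theorem le_insertAsc_self_iff {σ : Equiv.Perm ℕ} : i ≤ insertAsc i σ i ↔ i ≤ σ i := by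
  unfold insertAsc
  split_ifs with h
  · rw [shiftPerm_mul_simpleTransposition_self, ← not_lt, skip_lt_self_iff, not_lt]
  · simpa using h

theorem lt_insertAsc_succ_iff {σ : Equiv.Perm ℕ} : i < insertAsc i σ (i + 1) ↔ i ≤ σ i := by
  unfold insertAsc
  split_ifs with h
  · simpa using h
  · rw [shiftPerm_succ_of_le _ le_rfl, skip_of_le (not_lt.1 h), Nat.lt_succ_iff]

theorem insertAsc_lt (i : ℕ) (σ : Equiv.Perm ℕ) : insertAsc i σ i < insertAsc i σ (i + 1) := by
  unfold insertAsc
  split_ifs with h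
  · rw [shiftPerm_mul_simpleTransposition_self, shiftPerm_mul_simpleTransposition_succ]
    exact skip_lt_self_iff.2 h
  · rw [shiftPerm_self, shiftPerm_succ_of_le _ le_rfl, skip_of_le (not_lt.1 h)]
    omega

theorem le_insertDesc_self (i : ℕ) (σ : Equiv.Perm ℕ) : i ≤ insertDesc i σ i := by
  unfold insertDesc
  split_ifs with h
  · rw [shiftPerm_self]
  · rw [shiftPerm_mul_simpleTransposition_self, skip_of_le (not_lt.1 h)]
    omega

theorem insertDesc_succ_le (i : ℕ) (σ : Equiv.Perm ℕ) : insertDesc i σ (i + 1) ≤ i := by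
  unfold insertDesc
  split_ifs with h
  · rw [shiftPerm_succ_of_le _ le_rfl]
    exact (skip_lt_self_iff.2 h).le
  · rw [shiftPerm_mul_simpleTransposition_succ]

theorem insertDesc_self_eq_iff {σ : Equiv.Perm ℕ} : insertDesc i σ i = i ↔ σ i < i := by
  unfold insertDesc
  split_ifs with h
  · simpa using h
  · rw [shiftPerm_mul_simpleTransposition_self]
    simp [skip_ne, h]

theorem simpleTransposition_commute_shiftPerm {σ : Equiv.Perm ℕ} (h : σ i = i) :
    Commute (simpleTransposition i) (shiftPerm i σ) := by
  have hsucc : shiftPerm i σ (i + 1) = i + 1 := by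
    rw [shiftPerm_succ_of_le _ le_rfl, h, skip_of_le le_rfl]
  have := Equiv.mul_swap_eq_swap_mul (shiftPerm i σ) i (i + 1)
  rw [shiftPerm_self, hsucc] at this
  exact this.symm

theorem insertDesc_mul_of_apply_eq (σ : Equiv.Perm ℕ) {τ : Equiv.Perm ℕ} (h : τ i = i) :
    insertDesc i (σ * τ) = insertDesc i σ * shiftPerm i τ := by
  unfold insertDesc
  rw [Equiv.Perm.mul_apply, h, map_mul]
  split_ifs
  · rfl
  · rw [mul_assoc, mul_assoc, (simpleTransposition_commute_shiftPerm h).eq]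

theorem insertDesc_mul_of_apply_apply_eq {σ τ : Equiv.Perm ℕ} (h : σ (τ i) = τ i) :
    insertDesc i (σ * τ) = shiftPerm i σ * insertDesc i τ := by
  unfold insertDesc
  rw [Equiv.Perm.mul_apply, h, map_mul]
  split_ifs
  · rfl
  · rw [mul_assoc]

theorem insertDesc_skip (σ : Equiv.Perm ℕ) (h : k ≠ i) :
    insertDesc i σ (skip i k) = skip i (σ k) := by
  unfold insertDesc
  split_ifs
  · rw [shiftPerm_skip]
  · rw [shiftPerm_mul_simpleTransposition_skip σ h]

theorem exists_descent_of_insertDesc {σ : Equiv.Perm ℕ} (hne : k ≠ i)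
    (h1 : k ≤ insertDesc i σ k) (h2 : insertDesc i σ (k + 1) ≤ k) :
    ∃ m, (m + 1 < i ∨ i < m) ∧ skip i m = k ∧ m ≤ σ m ∧ σ (m + 1) ≤ m := by
  have hself := le_insertDesc_self i σ
  have hsucc := insertDesc_succ_le i σ
  have hk : k + 1 ≠ i := by rintro rfl; omega
  have hk' : k ≠ i + 1 := by rintro rfl; omega
  rcases eq_or_eq_skip i k with rfl | ⟨m, rfl⟩
  · exact absurd rfl hne
  have hm : m ≠ i := by rintro rfl; exact hk' (skip_of_le le_rfl)
  have hm' : m + 1 ≠ i := by rintro rfl; exact hk (by rw [skip_of_lt (Nat.lt_succ_self m)])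
  have hskip : skip i m + 1 = skip i (m + 1) := by unfold skip; split_ifs <;> omega
  rw [insertDesc_skip σ hm, (skip_strictMono i).le_iff_le] at h1
  rw [hskip, insertDesc_skip σ hm', (skip_strictMono i).le_iff_le] at h2
  exact ⟨m, by omega, rfl, h1, h2⟩

theorem insertDesc_injective (i : ℕ) : Function.Injective (insertDesc i) := by
  intro σ τ h
  have hiff : σ i < i ↔ τ i < i := by
    rw [← insertDesc_self_eq_iff, h, insertDesc_self_eq_iff]
  unfold insertDesc at h
  split_ifs at h with hσ hτ hτ
  · exact shiftPerm_injective i h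
  · exact absurd (hiff.1 hσ) hτ
  · exact absurd (hiff.2 hτ) hσ
  · exact shiftPerm_injective i (mul_right_cancel h)

end Insert

/-! ### Rank functions -/

section Rank

variable {i a b : ℕ}

/-- The rank function of a permutation: the number of `k < a` with `b ≤ σ k`. -/
def rank (σ : Equiv.Perm ℕ) (a b : ℕ) : ℕ := ((Finset.range a).filter fun k => b ≤ σ k).card

@[simp] theorem rank_zero (σ : Equiv.Perm ℕ) (b : ℕ) : rank σ 0 b = 0 := by simp [rank]

theorem rank_succ (σ : Equiv.Perm ℕ) (a b : ℕ) :
    rank σ (a + 1) b = rank σ a b + if b ≤ σ a then 1 else 0 := by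
  unfold rank
  rw [Finset.range_add_one, Finset.filter_insert]
  split_ifs <;> simp

theorem rank_succ_right (σ : Equiv.Perm ℕ) (a b : ℕ) :
    rank σ a b = rank σ a (b + 1) + if σ.symm b < a then 1 else 0 := by
  induction a with
  | zero => simp
  | succ a ih =>
    have hab : σ.symm b = a ↔ σ a = b := by rw [Equiv.symm_apply_eq, eq_comm]
    rw [rank_succ, rank_succ, ih]
    split_ifs <;> omega

theorem rank_shiftPerm (i : ℕ) (σ : Equiv.Perm ℕ) (a b : ℕ) :
    rank (shiftPerm i σ) a b =
      rank σ (if i < a then a - 1 else a) (if i < b then b - 1 else b) +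
        if i < a ∧ b ≤ i then 1 else 0 := by
  induction a with
  | zero => simp
  | succ a ih =>
    rw [rank_succ, ih]
    rcases lt_trichotomy a i with h | rfl | h
    · simp only [shiftPerm_of_lt σ h, le_skip_iff, h.not_gt, show ¬ i < a + 1 by omega, if_false,
        false_and, rank_succ, add_zero]
    · simp
    · obtain ⟨a, rfl⟩ : ∃ c, a = c + 1 := ⟨a - 1, by omega⟩
      simp only [shiftPerm_succ_of_le σ (Nat.le_of_lt_succ h), le_skip_iff, h, h.trans,
        Nat.lt_succ_self, if_true, true_and, Nat.add_sub_cancel, rank_succ, add_right_comm]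

theorem rank_mul_simpleTransposition_of_ne (τ : Equiv.Perm ℕ) (ha : a ≠ i + 1) (b : ℕ) :
    rank (τ * simpleTransposition i) a b = rank τ a b := by
  refine Finset.card_equiv (simpleTransposition i) fun k => ?_
  have hlt : simpleTransposition i k < a ↔ k < a := by
    simp only [simpleTransposition, Equiv.swap_apply_def]
    split_ifs <;> omega
  rw [Finset.mem_filter, Finset.mem_filter, Finset.mem_range, Finset.mem_range, hlt]; rfl

end Rank

/-! ### The ranks next to the diagonal -/

section DiagRank

variable {i m : ℕ} {π σ τ : Equiv.Perm ℕ}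

/-- The ranks `rank σ b b` and `rank σ (b + 1) b` along the diagonal, as one sequence with the
indices `2 * b` and `2 * b + 1`. -/
def diagRank (σ : Equiv.Perm ℕ) (m : ℕ) : ℕ := rank σ ((m + 1) / 2) (m / 2)

theorem diagRank_two_mul (σ : Equiv.Perm ℕ) (b : ℕ) : diagRank σ (2 * b) = rank σ b b := by
  unfold diagRank; congr <;> omega

theorem diagRank_two_mul_add_one (σ : Equiv.Perm ℕ) (b : ℕ) :
    diagRank σ (2 * b + 1) = rank σ (b + 1) b := by
  unfold diagRank; congr <;> omega

theorem diagRank_two_mul_add_one_eq (σ : Equiv.Perm ℕ) (b : ℕ) :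
    diagRank σ (2 * b + 1) = diagRank σ (2 * b) + if b ≤ σ b then 1 else 0 := by
  rw [diagRank_two_mul_add_one, diagRank_two_mul, rank_succ]

theorem diagRank_two_mul_add_three_eq (σ : Equiv.Perm ℕ) (b : ℕ) :
    diagRank σ (2 * b + 3) = diagRank σ (2 * b + 2) + if b < σ (b + 1) then 1 else 0 :=
  diagRank_two_mul_add_one_eq σ (b + 1)

theorem diagRank_shiftPerm_of_le (σ : Equiv.Perm ℕ) (hm : m ≤ 2 * i) :
    diagRank (shiftPerm i σ) m = diagRank σ m := by
  rw [diagRank, rank_shiftPerm, if_neg (by omega), if_neg (by omega), if_neg (by omega), add_zero,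
    diagRank]

theorem diagRank_shiftPerm_add_two (σ : Equiv.Perm ℕ) (hm : 2 * i < m) :
    diagRank (shiftPerm i σ) (m + 2) = diagRank σ m := by
  rw [diagRank, rank_shiftPerm, if_pos (by omega), if_pos (by omega), if_neg (by omega), add_zero,
    diagRank]
  congr 1 <;> omega

theorem diagRank_mul_simpleTransposition (τ : Equiv.Perm ℕ) (hm : m ≤ 2 * i ∨ 2 * i + 2 < m) :
    diagRank (τ * simpleTransposition i) m = diagRank τ m :=
  rank_mul_simpleTransposition_of_ne τ (by omega) _

theorem diagRank_insertDesc (σ : Equiv.Perm ℕ) (hm : m ≤ 2 * i ∨ 2 * i + 2 < m) :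
    diagRank (insertDesc i σ) m = diagRank (shiftPerm i σ) m := by
  unfold insertDesc
  split_ifs
  · rfl
  · exact diagRank_mul_simpleTransposition _ hm

theorem diagRank_insertDesc_of_le (σ : Equiv.Perm ℕ) (hm : m ≤ 2 * i) :
    diagRank (insertDesc i σ) m = diagRank σ m := by
  rw [diagRank_insertDesc σ (.inl hm), diagRank_shiftPerm_of_le σ hm]

theorem diagRank_insertDesc_add_two (σ : Equiv.Perm ℕ) (hm : 2 * i < m) :
    diagRank (insertDesc i σ) (m + 2) = diagRank σ m := by
  rw [diagRank_insertDesc σ (.inr (by omega)), diagRank_shiftPerm_add_two σ hm]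

theorem diagRank_insertDesc_two_mul_add_one (i : ℕ) (σ : Equiv.Perm ℕ) :
    diagRank (insertDesc i σ) (2 * i + 1) = diagRank σ (2 * i) + 1 := by
  rw [diagRank_two_mul_add_one_eq, if_pos (le_insertDesc_self i σ),
    diagRank_insertDesc_of_le σ le_rfl]

theorem diagRank_insertDesc_two_mul_add_two (i : ℕ) (σ : Equiv.Perm ℕ) :
    diagRank (insertDesc i σ) (2 * i + 2) = diagRank σ (2 * i + 1) := by
  rw [← diagRank_insertDesc_add_two σ (Nat.lt_succ_self _), diagRank_two_mul_add_three_eq,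
    if_neg (insertDesc_succ_le i σ).not_gt, add_zero]

theorem diagRank_insertAsc (σ : Equiv.Perm ℕ) (hm : m ≤ 2 * i ∨ 2 * i + 2 < m) :
    diagRank (insertAsc i σ) m = diagRank (insertDesc i σ) m := by
  rw [← insertAsc_mul, diagRank_mul_simpleTransposition _ hm]

theorem diagRank_insertAsc_of_le (σ : Equiv.Perm ℕ) (hm : m ≤ 2 * i) :
    diagRank (insertAsc i σ) m = diagRank σ m := by
  rw [diagRank_insertAsc σ (.inl hm), diagRank_insertDesc_of_le σ hm]

theorem diagRank_insertAsc_add_two (σ : Equiv.Perm ℕ) (hm : 2 * i < m) :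
    diagRank (insertAsc i σ) (m + 2) = diagRank σ m := by
  rw [diagRank_insertAsc σ (.inr (by omega)), diagRank_insertDesc_add_two σ hm]

theorem diagRank_insertAsc_two_mul_add_one (i : ℕ) (σ : Equiv.Perm ℕ) :
    diagRank (insertAsc i σ) (2 * i + 1) = diagRank σ (2 * i + 1) := by
  simp only [diagRank_two_mul_add_one_eq, diagRank_insertAsc_of_le σ le_rfl, le_insertAsc_self_iff]

theorem diagRank_insertAsc_two_mul_add_two (i : ℕ) (σ : Equiv.Perm ℕ) :
    diagRank (insertAsc i σ) (2 * i + 2) = diagRank σ (2 * i) := by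
  have h : diagRank (insertAsc i σ) (2 * i + 3) = diagRank σ (2 * i + 1) :=
    diagRank_insertAsc_add_two σ (Nat.lt_succ_self _)
  simp only [diagRank_two_mul_add_three_eq, diagRank_two_mul_add_one_eq,
    lt_insertAsc_succ_iff] at h
  exact Nat.add_right_cancel h

theorem le_two_mul_or_eq_or_exists (i m : ℕ) :
    m ≤ 2 * i ∨ m = 2 * i + 1 ∨ m = 2 * i + 2 ∨ ∃ k, 2 * i < k ∧ m = k + 2 := by
  by_cases h : 2 * i + 2 < m
  · exact .inr (.inr (.inr ⟨m - 2, by omega, by omega⟩))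
  · omega

/-- Comparison of the ranks on and next to the diagonal, a necessary condition for the Bruhat order
that turns out to be sufficient for noncrossing permutations. -/
def RankLE (π σ : Equiv.Perm ℕ) : Prop := ∀ m, diagRank π m ≤ diagRank σ m

theorem RankLE.trans (h : RankLE π σ) (h' : RankLE σ τ) : RankLE π τ :=
  fun m => (h m).trans (h' m)

theorem rankLE_insertAsc_insertDesc (i : ℕ) (σ : Equiv.Perm ℕ) :
    RankLE (insertAsc i σ) (insertDesc i σ) := by
  have h := diagRank_two_mul_add_one_eq σ i
  intro m
  rcases le_two_mul_or_eq_or_exists i m with hm | rfl | rfl | ⟨k, hk, rfl⟩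
  · rw [diagRank_insertAsc_of_le σ hm, diagRank_insertDesc_of_le σ hm]
  · rw [diagRank_insertAsc_two_mul_add_one, diagRank_insertDesc_two_mul_add_one]
    split_ifs at h <;> omega
  · rw [diagRank_insertAsc_two_mul_add_two, diagRank_insertDesc_two_mul_add_two]
    omega
  · rw [diagRank_insertAsc_add_two σ hk, diagRank_insertDesc_add_two σ hk]

theorem RankLE.insertAsc (h : RankLE π σ) (i : ℕ) : RankLE (insertAsc i π) (insertAsc i σ) := by
  intro m
  rcases le_two_mul_or_eq_or_exists i m with hm | rfl | rfl | ⟨k, hk, rfl⟩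
  · simpa only [diagRank_insertAsc_of_le _ hm] using h m
  · simpa only [diagRank_insertAsc_two_mul_add_one] using h _
  · simpa only [diagRank_insertAsc_two_mul_add_two] using h _
  · simpa only [diagRank_insertAsc_add_two _ hk] using h k

theorem rankLE_insertDesc_iff : RankLE (insertDesc i π) (insertDesc i σ) ↔ RankLE π σ := by
  refine ⟨fun h m => ?_, fun h m => ?_⟩
  · rcases le_or_gt m (2 * i) with hm | hm
    · simpa only [diagRank_insertDesc_of_le _ hm] using h m
    · simpa only [diagRank_insertDesc_add_two _ hm] using h (m + 2)
  · rcases le_two_mul_or_eq_or_exists i m with hm | rfl | rfl | ⟨k, hk, rfl⟩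
    · simpa only [diagRank_insertDesc_of_le _ hm] using h m
    · simpa only [diagRank_insertDesc_two_mul_add_one] using Nat.succ_le_succ (h (2 * i))
    · simpa only [diagRank_insertDesc_two_mul_add_two] using h _
    · simpa only [diagRank_insertDesc_add_two _ hk] using h k

theorem RankLE.insertAsc_of_insertDesc (h : RankLE π (insertDesc i σ))
    (hi : π i < i ∨ i < π (i + 1)) : RankLE π (DoubleForest.insertAsc i σ) := by
  have h0 := h (2 * i)
  have h1 := h (2 * i + 1)
  have h2 := h (2 * i + 2)
  have h3 : diagRank π (2 * i + 3) ≤ diagRank σ (2 * i + 1) :=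
    (h _).trans_eq (diagRank_insertDesc_add_two σ (Nat.lt_succ_self _))
  rw [diagRank_insertDesc_of_le σ le_rfl] at h0
  rw [diagRank_insertDesc_two_mul_add_one] at h1
  rw [diagRank_insertDesc_two_mul_add_two] at h2
  have hσ := diagRank_two_mul_add_one_eq σ i
  have hπ := diagRank_two_mul_add_one_eq π i
  have hπ' := diagRank_two_mul_add_three_eq π i
  have hdrop : diagRank π (2 * i + 1) =
      diagRank π (2 * i + 2) + if π.symm i < i + 1 then 1 else 0 := by
    rw [diagRank_two_mul_add_one, rank_succ_right]
    exact congrArg (· + _) (diagRank_two_mul π (i + 1)).symm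
  intro m
  rcases le_two_mul_or_eq_or_exists i m with hm | rfl | rfl | ⟨k, hk, rfl⟩
  · simpa only [diagRank_insertAsc_of_le σ hm, diagRank_insertDesc_of_le σ hm] using h m
  · rw [diagRank_insertAsc_two_mul_add_one]
    split_ifs at hσ hπ hπ' hdrop <;> omega
  · rw [diagRank_insertAsc_two_mul_add_two]
    split_ifs at hσ hπ hπ' hdrop <;> omega
  · simpa only [diagRank_insertAsc_add_two σ hk, diagRank_insertDesc_add_two σ hk] using h (k + 2)

theorem eq_one_of_forall_le (h : ∀ k, π k ≤ k) : π = 1 := by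
  ext k
  rw [Equiv.Perm.one_apply]
  induction k using Nat.strong_induction_on with
  | _ k ih =>
    rcases (h k).eq_or_lt with h | h
    · exact h
    · exact absurd (π.injective (ih _ h)) h.ne

theorem diagRank_one_two_mul (b : ℕ) : diagRank 1 (2 * b) = 0 := by
  rw [diagRank_two_mul, rank, Finset.card_eq_zero, Finset.filter_eq_empty_iff]
  exact fun k hk => (Finset.mem_range.1 hk).not_ge

theorem RankLE.eq_one (h : RankLE π 1) : π = 1 := by
  refine eq_one_of_forall_le fun k => ?_
  have hk := h (2 * k + 2)
  rw [show 2 * k + 2 = 2 * (k + 1) by ring, diagRank_one_two_mul, diagRank_two_mul, rank_succ] at hk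
  split_ifs at hk <;> omega

end DiagRank

/-! ### Inversions and reduced words -/

section Inversions

variable {i : ℕ} {π σ τ : Equiv.Perm ℕ} {v w : List ℕ}

/-- The inversions of a permutation, as pairs of positions. -/
def inversions (τ : Equiv.Perm ℕ) : Set (ℕ × ℕ) := {p | p.1 < p.2 ∧ τ p.2 < τ p.1}

theorem simpleTransposition_simpleTransposition (i a : ℕ) :
    simpleTransposition i (simpleTransposition i a) = a := Equiv.swap_apply_self _ _ _

theorem simpleTransposition_lt {a b : ℕ} (h : a < b) (h' : ¬ (a = i ∧ b = i + 1)) :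
    simpleTransposition i a < simpleTransposition i b := by
  simp only [simpleTransposition, Equiv.swap_apply_def]
  split_ifs <;> omega

theorem inversions_mul_simpleTransposition (h : τ i < τ (i + 1)) :
    inversions (τ * simpleTransposition i) = insert (i, i + 1)
      (Prod.map (simpleTransposition i) (simpleTransposition i) '' inversions τ) := by
  ext ⟨a, b⟩
  constructor
  · rintro ⟨hab, hτ⟩
    by_cases hne : a = i ∧ b = i + 1
    · exact Or.inl (by rw [hne.1, hne.2])
    · refine Or.inr ⟨(simpleTransposition i a, simpleTransposition i b),
        ⟨simpleTransposition_lt hab hne, hτ⟩, ?_⟩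
      simp only [Prod.map_apply, simpleTransposition_simpleTransposition]
  · rintro (heq | ⟨⟨c, d⟩, ⟨hcd, hτ⟩, heq⟩)
    · obtain ⟨rfl, rfl⟩ := Prod.mk.inj heq
      exact ⟨Nat.lt_succ_self _, by simpa using h⟩
    · obtain ⟨rfl, rfl⟩ := Prod.mk.inj heq
      refine ⟨simpleTransposition_lt hcd ?_, ?_⟩
      · rintro ⟨rfl, rfl⟩
        exact hτ.not_gt h
      · simpa [simpleTransposition_simpleTransposition] using hτ

theorem notMem_image_inversions :
    (i, i + 1) ∉ Prod.map (simpleTransposition i) (simpleTransposition i) '' inversions τ := by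
  rintro ⟨⟨c, d⟩, ⟨hcd, -⟩, heq⟩
  obtain ⟨hc, hd⟩ := Prod.mk.inj heq
  have hc' : c = i + 1 := by
    simpa [simpleTransposition_simpleTransposition] using congrArg (simpleTransposition i) hc
  have hd' : d = i := by
    simpa [simpleTransposition_simpleTransposition] using congrArg (simpleTransposition i) hd
  simp only at hcd
  omega

theorem encard_inversions_mul_simpleTransposition (h : τ i < τ (i + 1)) :
    (inversions (τ * simpleTransposition i)).encard = (inversions τ).encard + 1 := by
  have hinj := (simpleTransposition i).injective
  rw [inversions_mul_simpleTransposition h, Set.encard_insert_of_notMem notMem_image_inversions,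
    (hinj.prodMap hinj).encard_image]

theorem encard_inversions_of_gt (h : τ (i + 1) < τ i) :
    (inversions τ).encard = (inversions (τ * simpleTransposition i)).encard + 1 := by
  have h' : (τ * simpleTransposition i) i < (τ * simpleTransposition i) (i + 1) := by
    simpa using h
  rw [← encard_inversions_mul_simpleTransposition h', mul_assoc, simpleTransposition_mul_self,
    mul_one]

theorem inversions_one : inversions 1 = ∅ :=
  Set.eq_empty_of_forall_notMem fun _ h => h.1.not_gt h.2

theorem wordProd_concat (w : List ℕ) (i : ℕ) :
    wordProd (w ++ [i]) = wordProd w * simpleTransposition i := by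
  simp [wordProd]

theorem encard_inversions_wordProd_le (w : List ℕ) :
    (inversions (wordProd w)).encard ≤ w.length := by
  induction w using List.reverseRecOn with
  | nil => exact (congrArg Set.encard inversions_one).trans_le (by simp)
  | append_singleton w i ih =>
    rw [wordProd_concat, List.length_append, List.length_singleton, Nat.cast_add, Nat.cast_one]
    rcases lt_or_gt_of_ne ((wordProd w).injective.ne i.lt_succ_self.ne) with h | h
    · rw [encard_inversions_mul_simpleTransposition h]
      gcongr
    · rw [encard_inversions_of_gt h] at ih
      exact le_self_add.trans (ih.trans le_self_add)

/-- `w` is a word of `σ` with as many letters as `σ` has inversions. Such words are the reduced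
words of the finitary permutations, without minimizing over all words. -/
def IsExactWord (w : List ℕ) (σ : Equiv.Perm ℕ) : Prop :=
  wordProd w = σ ∧ (inversions σ).encard = w.length

theorem IsExactWord.isReducedWord (h : IsExactWord w σ) : IsReducedWord w σ := by
  refine ⟨h.1, fun v hv => ?_⟩
  have hle := encard_inversions_wordProd_le v
  rw [hv, h.2] at hle
  exact_mod_cast hle

theorem IsReducedWord.isExactWord (h : IsReducedWord w σ) (hv : IsExactWord v σ) :
    IsExactWord w σ := by
  refine ⟨h.1, le_antisymm ?_ ?_⟩
  · simpa only [h.1] using encard_inversions_wordProd_le w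
  · rw [hv.2]
    exact_mod_cast h.2 v hv.1

theorem isExactWord_nil : IsExactWord [] 1 := ⟨rfl, by simp [inversions_one]⟩

theorem IsExactWord.concat (h : IsExactWord w τ) (hi : τ i < τ (i + 1)) :
    IsExactWord (w ++ [i]) (τ * simpleTransposition i) := by
  refine ⟨by rw [wordProd_concat, h.1], ?_⟩
  rw [encard_inversions_mul_simpleTransposition hi, h.2]
  simp

theorem IsExactWord.of_concat (h : IsExactWord (w ++ [i]) (wordProd (w ++ [i]))) :
    IsExactWord w (wordProd w) ∧ wordProd w i < wordProd w (i + 1) := by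
  have hcard := h.2
  rw [wordProd_concat, List.length_append, List.length_singleton, Nat.cast_add, Nat.cast_one]
    at hcard
  rcases lt_or_gt_of_ne ((wordProd w).injective.ne i.lt_succ_self.ne) with hi | hi
  · rw [encard_inversions_mul_simpleTransposition hi] at hcard
    exact ⟨⟨rfl, ENat.add_left_injective_of_ne_top (by simp) hcard⟩, hi⟩
  · have hle := encard_inversions_wordProd_le w
    rw [encard_inversions_of_gt hi, hcard] at hle
    norm_cast at hle
    omega

theorem rank_mul_simpleTransposition_succ (τ : Equiv.Perm ℕ) (i b : ℕ) :
    rank (τ * simpleTransposition i) (i + 1) b = rank τ i b + if b ≤ τ (i + 1) then 1 else 0 := by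
  rw [rank_succ, rank_mul_simpleTransposition_of_ne τ i.lt_succ_self.ne, Equiv.Perm.mul_apply,
    simpleTransposition_self]

theorem rank_le_rank_mul_simpleTransposition (h : τ i < τ (i + 1)) (a b : ℕ) :
    rank τ a b ≤ rank (τ * simpleTransposition i) a b := by
  by_cases ha : a = i + 1
  · rw [ha, rank_mul_simpleTransposition_succ, rank_succ]
    split_ifs <;> omega
  · rw [rank_mul_simpleTransposition_of_ne _ ha]

theorem rank_mul_simpleTransposition_mono (hle : ∀ a b, rank π a b ≤ rank τ a b)
    (h : τ i < τ (i + 1)) (a b : ℕ) :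
    rank (π * simpleTransposition i) a b ≤ rank (τ * simpleTransposition i) a b := by
  by_cases ha : a = i + 1
  · rw [ha, rank_mul_simpleTransposition_succ, rank_mul_simpleTransposition_succ]
    have hi := hle i b
    have hi' := hle (i + 2) b
    rw [rank_succ, rank_succ, rank_succ τ, rank_succ τ] at hi'
    split_ifs at * <;> omega
  · simpa only [rank_mul_simpleTransposition_of_ne _ ha] using hle a b

theorem rank_wordProd_le (hw : IsExactWord w (wordProd w)) (hvw : v.Sublist w) (a b : ℕ) :
    rank (wordProd v) a b ≤ rank (wordProd w) a b := by
  induction w using List.reverseRecOn generalizing v a b with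
  | nil => rw [List.sublist_nil.1 hvw]
  | append_singleton w i ih =>
    obtain ⟨hw', hi⟩ := hw.of_concat
    obtain ⟨v', u, rfl, hv', hu⟩ := List.sublist_append_iff.1 hvw
    rw [wordProd_concat]
    rcases List.sublist_singleton.1 hu with rfl | rfl
    · rw [List.append_nil]
      exact (ih hw' hv' a b).trans (rank_le_rank_mul_simpleTransposition hi a b)
    · rw [wordProd_concat]
      exact rank_mul_simpleTransposition_mono (ih hw' hv') hi a b

theorem BruhatLE.rankLE (h : BruhatLE π σ) (hσ : ∃ w, IsExactWord w σ) : RankLE π σ := by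
  obtain ⟨v, w, hv, hw, hvw⟩ := h
  obtain ⟨w₀, hw₀⟩ := hσ
  have hw' := hw.isExactWord hw₀
  rw [← hv.1, ← hw.1]
  rw [← hw.1] at hw'
  exact fun m => rank_wordProd_le hw' hvw _ _

end Inversions

/-! ### Noncrossing permutations as labellings -/

section BackwardCycle

variable {B : Finset ℕ} {L : List (Finset ℕ)} {j k : ℕ}

theorem backwardCycle_of_notMem (h : k ∉ B) : backwardCycle B k = k :=
  List.formPerm_apply_of_notMem (by rwa [Finset.mem_sort])

theorem backwardCycle_mem (h : k ∈ B) : backwardCycle B k ∈ B := by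
  rw [← Finset.mem_sort (· ≥ ·)] at h ⊢
  exact List.formPerm_apply_mem_of_mem h

theorem backwardCycle_between (hk : k ∈ B) (hj : j ∈ B) :
    backwardCycle B k < k ∧ (j ≤ backwardCycle B k ∨ k ≤ j) ∨
      k ≤ j ∧ j ≤ backwardCycle B k := by
  obtain ⟨a, ha, rfl⟩ := List.mem_iff_getElem.1 ((Finset.mem_sort (· ≥ ·)).2 hk)
  obtain ⟨b, hb, rfl⟩ := List.mem_iff_getElem.1 ((Finset.mem_sort (· ≥ ·)).2 hj)
  have hl := B.sortedGT_sort
  have happ := List.formPerm_apply_getElem _ hl.nodup a ha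
  rw [backwardCycle, happ, hl.getElem_lt_getElem_iff, hl.getElem_le_getElem_iff,
    hl.getElem_le_getElem_iff]
  rcases (show a + 1 ≤ _ from ha).eq_or_lt with ha | ha
  · rw [ha, Nat.mod_self]
    omega
  · rw [Nat.mod_eq_of_lt ha]
    omega

theorem blocksPerm_cons (B : Finset ℕ) (L : List (Finset ℕ)) :
    blocksPerm (B :: L) = backwardCycle B * blocksPerm L := by
  simp [blocksPerm]

theorem blocksPerm_of_notMem (h : ∀ B ∈ L, k ∉ B) : blocksPerm L k = k := by
  induction L with
  | nil => rfl
  | cons B L ih =>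
    rw [blocksPerm_cons, Equiv.Perm.mul_apply, ih fun C hC => h C (List.mem_cons_of_mem _ hC),
      backwardCycle_of_notMem (h B List.mem_cons_self)]

theorem blocksPerm_of_mem (hL : L.Pairwise Disjoint) (hB : B ∈ L) (hk : k ∈ B) :
    blocksPerm L k = backwardCycle B k := by
  induction L with
  | nil => simp at hB
  | cons C L ih =>
    rw [List.pairwise_cons] at hL
    rw [blocksPerm_cons, Equiv.Perm.mul_apply]
    rcases List.mem_cons.1 hB with rfl | hB
    · rw [blocksPerm_of_notMem fun D hD hkD => Finset.disjoint_left.1 (hL.1 D hD) hk hkD]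
    · rw [ih hL.2 hB, backwardCycle_of_notMem fun h =>
        Finset.disjoint_left.1 (hL.1 B hB) h (backwardCycle_mem hk)]

end BackwardCycle

section Labelling

variable {n i : ℕ} {α : Type*} {β : ℕ → α} {σ τ : Equiv.Perm ℕ}

/-- `β` labels the blocks of the set partition `P` of `[n]`, all `k ≥ n` being singletons. -/
def IsLabelling (P : Finpartition (Finset.range n)) (β : ℕ → α) : Prop :=
  ∀ j k, β j = β k ↔ j = k ∨ ∃ B ∈ P.parts, j ∈ B ∧ k ∈ B

/-- The partition of `ℕ` into the fibres of `β` is noncrossing. -/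
def Noncrossing (β : ℕ → α) : Prop :=
  ∀ ⦃a b c d⦄, a < c → c < b → b < d → β a = β b → β c = β d → β a = β c

/-- `σ` sends every `k` to the next smaller element of its fibre under `β`, and the minima of the
fibres to the maxima: no element `j` of the fibre is cyclically between `σ k` and `k`. -/
structure IsBackward (β : ℕ → α) (σ : Equiv.Perm ℕ) : Prop where
  label_apply : ∀ k, β (σ k) = β k
  between : ∀ {j k}, β j = β k → σ k < k ∧ (j ≤ σ k ∨ k ≤ j) ∨ k ≤ j ∧ j ≤ σ k

theorem IsBackward.unique (hσ : IsBackward β σ) (hτ : IsBackward β τ) : σ = τ := by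
  ext k
  have hστ := hσ.between (hτ.label_apply k)
  have hτσ := hτ.between (hσ.label_apply k)
  omega

theorem exists_isLabelling (P : Finpartition (Finset.range n)) : ∃ β : ℕ → ℕ, IsLabelling P β := by
  refine ⟨fun k => Encodable.encode (insert k (P.part k)), fun j k => ?_⟩
  rw [Encodable.encode_inj, ← P.mem_part_iff_exists]
  refine ⟨fun h => ?_, ?_⟩
  · rw [← Finset.mem_insert, ← h]
    exact Finset.mem_insert_self _ _
  · rintro (rfl | h)
    · rfl
    · have hj : j ∈ Finset.range n := P.part_subset k h
      have hk : k ∈ Finset.range n := by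
        by_contra hk
        simp [P.part_eq_empty.2 hk] at h
      rw [Finset.insert_eq_of_mem (P.mem_part hj), Finset.insert_eq_of_mem (P.mem_part hk),
        (P.mem_part_iff_part_eq_part hj hk).1 h]

theorem exists_isLabelling_of_eq_of_le (hβ : ∀ j k, n ≤ k → β j = β k → j = k) :
    ∃ P : Finpartition (Finset.range n), IsLabelling P β := by
  classical
  refine ⟨Finpartition.ofSetSetoid (Setoid.ker β) (Finset.range n), fun j k => ?_⟩
  rw [← Finpartition.mem_part_iff_exists, Finpartition.mem_part_ofSetSetoid_iff_rel,
    Finset.mem_range, Finset.mem_range, Setoid.ker_def]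
  refine ⟨fun h => ?_, ?_⟩
  · rcases le_or_gt n j with hj | hj
    · exact .inl (hβ k j hj h.symm).symm
    rcases le_or_gt n k with hk | hk
    · exact .inl (hβ j k hk h)
    · exact .inr ⟨hk, hj, h.symm⟩
  · rintro (rfl | ⟨-, -, h⟩)
    · rfl
    · exact h.symm

namespace IsLabelling

variable {P : Finpartition (Finset.range n)}

theorem eq_of_le (h : IsLabelling P β) {j k : ℕ} (hk : n ≤ k) (hj : β j = β k) : j = k := by
  rcases (h j k).1 hj with hj | ⟨B, hB, -, hkB⟩
  · exact hj
  · exact absurd (Finset.mem_range.1 (P.le hB hkB)) hk.not_gt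

theorem noncrossing_iff (h : IsLabelling P β) : Noncrossing β ↔ IsNoncrossing P := by
  constructor
  · rintro hβ B hB C hC hne a ha b hb c hc d hd ⟨hac, hcb, hbd⟩
    have hβac := hβ hac hcb hbd ((h a b).2 (.inr ⟨B, hB, ha, hb⟩))
      ((h c d).2 (.inr ⟨C, hC, hc, hd⟩))
    obtain ⟨D, hD, haD, hcD⟩ := ((h a c).1 hβac).resolve_left hac.ne
    exact hne ((P.eq_of_mem_parts hB hD ha haD).trans (P.eq_of_mem_parts hD hC hcD hc))
  · intro hP a b c d hac hcb hbd hab hcd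
    obtain ⟨B, hB, ha, hb⟩ := ((h a b).1 hab).resolve_left (hac.trans hcb).ne
    obtain ⟨C, hC, hc, hd⟩ := ((h c d).1 hcd).resolve_left (hcb.trans hbd).ne
    by_cases hne : B = C
    · exact (h a c).2 (.inr ⟨B, hB, ha, hne ▸ hc⟩)
    · exact absurd ⟨hac, hcb, hbd⟩ (hP B hB C hC hne a ha b hb c hc d hd)

theorem isBackward (h : IsLabelling P β) : IsBackward β (blocksPerm P.parts.toList) := by
  have hdisj : P.parts.toList.Pairwise Disjoint :=
    P.parts.nodup_toList.pairwise_of_forall_ne fun B hB C hC hne =>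
      P.disjoint (Finset.mem_toList.1 hB) (Finset.mem_toList.1 hC) hne
  have happ : ∀ {B k}, B ∈ P.parts → k ∈ B → blocksPerm P.parts.toList k = backwardCycle B k :=
    fun hB hk => blocksPerm_of_mem hdisj (Finset.mem_toList.2 hB) hk
  refine ⟨fun k => ?_, fun {j k} hjk => ?_⟩
  · rw [h]
    by_cases hk : ∃ B ∈ P.parts, k ∈ B
    · obtain ⟨B, hB, hk⟩ := hk
      rw [happ hB hk]
      exact .inr ⟨B, hB, backwardCycle_mem hk, hk⟩
    · push Not at hk
      exact .inl (blocksPerm_of_notMem fun B hB => hk B (Finset.mem_toList.1 hB))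
  · rcases (h j k).1 hjk with rfl | ⟨B, hB, hj, hk⟩
    · rcases lt_or_ge (blocksPerm P.parts.toList j) j with hlt | hge
      · exact .inl ⟨hlt, .inr le_rfl⟩
      · exact .inr ⟨le_rfl, hge⟩
    · rw [happ hB hk]
      exact backwardCycle_between hk hj

end IsLabelling

/-- `β` labels the blocks of a noncrossing set partition of `[n]`, all `k ≥ n` being singletons. -/
structure IsNCLabelling (n : ℕ) (β : ℕ → α) : Prop where
  noncrossing : Noncrossing β
  eq_of_le : ∀ {j k}, n ≤ k → β j = β k → j = k

theorem IsNCLabelling.mem_noncrossingPerms (hβ : IsNCLabelling n β) (hσ : IsBackward β σ) :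
    σ ∈ noncrossingPerms n := by
  obtain ⟨P, hP⟩ := exists_isLabelling_of_eq_of_le fun _ _ => hβ.eq_of_le
  exact ⟨P, hP.noncrossing_iff.1 hβ.noncrossing, hσ.unique hP.isBackward⟩

theorem exists_isNCLabelling (h : σ ∈ noncrossingPerms n) :
    ∃ β : ℕ → ℕ, IsNCLabelling n β ∧ IsBackward β σ := by
  obtain ⟨P, hP, rfl⟩ := h
  obtain ⟨β, hβ⟩ := exists_isLabelling P
  exact ⟨β, ⟨hβ.noncrossing_iff.2 hP, hβ.eq_of_le⟩, hβ.isBackward⟩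

theorem IsNCLabelling.comp_injective {γ : Type*} {f : α → γ} (hf : f.Injective)
    (hβ : IsNCLabelling n β) : IsNCLabelling n (f ∘ β) where
  noncrossing _ _ _ _ hac hcb hbd hab hcd :=
    congrArg f (hβ.noncrossing hac hcb hbd (hf hab) (hf hcd))
  eq_of_le hk hj := hβ.eq_of_le hk (hf hj)

theorem IsBackward.comp_injective {γ : Type*} {f : α → γ} (hf : f.Injective)
    (h : IsBackward β σ) : IsBackward (f ∘ β) σ where
  label_apply k := congrArg f (h.label_apply k)
  between hj := h.between (hf hj)

theorem Noncrossing.comp_monotone (hβ : Noncrossing β) {p : ℕ → ℕ} (hp : Monotone p) :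
    Noncrossing (β ∘ p) := by
  intro a b c d hac hcb hbd hab hcd
  simp only [Function.comp_apply] at *
  rcases (hp hac.le).eq_or_lt with h | hac
  · rw [h]
  rcases (hp hcb.le).eq_or_lt with h | hcb
  · rw [hab, h]
  rcases (hp hbd.le).eq_or_lt with h | hbd
  · rw [hab, hcd, h]
  exact hβ hac hcb hbd hab hcd

namespace IsNCLabelling

theorem comp_skip (hβ : IsNCLabelling (n + 1) β) (hi : i ≤ n) : IsNCLabelling n (β ∘ skip i) where
  noncrossing := hβ.noncrossing.comp_monotone (skip_strictMono i).monotone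
  eq_of_le {j k} hk hj := by
    refine (skip_strictMono i).injective (hβ.eq_of_le ?_ hj)
    rw [skip_of_le (hi.trans hk)]
    exact Nat.succ_le_succ hk

theorem of_isolated (hβ : IsNCLabelling n (β ∘ skip i)) (hi : i ≤ n)
    (hiso : ∀ j, β j = β i → j = i) : IsNCLabelling (n + 1) β where
  noncrossing a b c d hac hcb hbd hab hcd := by
    rcases eq_or_eq_skip i a with rfl | ⟨a, rfl⟩
    · exact absurd (hiso b hab.symm) (hac.trans hcb).ne'
    rcases eq_or_eq_skip i b with rfl | ⟨b, rfl⟩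
    · exact absurd (hiso _ hab) (hac.trans hcb).ne
    rcases eq_or_eq_skip i c with rfl | ⟨c, rfl⟩
    · exact absurd (hiso d hcd.symm) (hcb.trans hbd).ne'
    rcases eq_or_eq_skip i d with rfl | ⟨d, rfl⟩
    · exact absurd (hiso _ hcd) (hcb.trans hbd).ne
    rw [(skip_strictMono i).lt_iff_lt] at hac hcb hbd
    exact hβ.noncrossing hac hcb hbd hab hcd
  eq_of_le {j k} hk hj := by
    rcases eq_or_eq_skip i k with rfl | ⟨k, rfl⟩
    · exact hiso j hj
    rcases eq_or_eq_skip i j with rfl | ⟨j, rfl⟩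
    · exact (hiso _ hj.symm).symm
    have hnk : n ≤ k := by
      unfold skip at hk
      split_ifs at hk <;> omega
    rw [hβ.eq_of_le hnk hj]

theorem of_doubled (hβ : IsNCLabelling n (β ∘ skip i)) (hi : i < n) (hdup : β i = β (i + 1)) :
    IsNCLabelling (n + 1) β := by
  have hcomp : β = (β ∘ skip i) ∘ fun k => if k ≤ i then k else k - 1 := by
    funext k
    rcases eq_or_eq_skip i k with rfl | ⟨k, rfl⟩
    · simp only [Function.comp_apply, le_refl, if_true, skip_of_le, hdup]
    · have hk : (if skip i k ≤ i then skip i k else skip i k - 1) = k := by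
        unfold skip
        split_ifs <;> omega
      simp only [Function.comp_apply, hk]
  rw [hcomp]
  refine ⟨hβ.noncrossing.comp_monotone fun a b hab => ?_, fun {j k} hk hj => ?_⟩
  · split_ifs <;> omega
  · have hj' := hβ.eq_of_le (show n ≤ if k ≤ i then k else k - 1 by split_ifs <;> omega) hj
    simp only at hj'
    split_ifs at hj' <;> omega

end IsNCLabelling

theorem isBackward_shiftPerm_iff (hiso : ∀ j, β j = β i → j = i) :
    IsBackward β (shiftPerm i σ) ↔ IsBackward (β ∘ skip i) σ := by
  constructor
  · refine fun h => ⟨fun k => ?_, fun {j k} hj => ?_⟩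
    · simpa only [Function.comp_apply, shiftPerm_skip] using h.label_apply (skip i k)
    · simpa only [shiftPerm_skip, (skip_strictMono i).lt_iff_lt, (skip_strictMono i).le_iff_le]
        using h.between hj
  · refine fun h => ⟨fun k => ?_, fun {j k} hj => ?_⟩
    · rcases eq_or_eq_skip i k with rfl | ⟨k, rfl⟩
      · rw [shiftPerm_self]
      · rw [shiftPerm_skip]
        exact h.label_apply k
    · rcases eq_or_eq_skip i k with rfl | ⟨k, rfl⟩
      · rw [hiso j hj, shiftPerm_self]
        exact .inr ⟨le_rfl, le_rfl⟩
      rcases eq_or_eq_skip i j with rfl | ⟨j, rfl⟩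
      · exact absurd (hiso _ hj.symm) (skip_ne _ _)
      · simpa only [shiftPerm_skip, (skip_strictMono i).lt_iff_lt, (skip_strictMono i).le_iff_le]
          using h.between hj

theorem IsBackward.of_shiftPerm_mul (hdup : β i = β (i + 1))
    (h : IsBackward β (shiftPerm i σ * simpleTransposition i)) :
    IsBackward (β ∘ skip i) σ := by
  refine ⟨fun k => ?_, fun {j k} hj => ?_⟩
  · rcases eq_or_ne k i with rfl | hk
    · have hk := h.label_apply k
      rw [shiftPerm_mul_simpleTransposition_self, hdup, ← skip_of_le le_rfl] at hk
      exact hk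
    · simpa only [Function.comp_apply, shiftPerm_mul_simpleTransposition_skip σ hk]
        using h.label_apply (skip i k)
  · rcases eq_or_ne k i with rfl | hk
    · have hk := h.between (j := skip k j) (k := k) (by rw [hdup, ← skip_of_le le_rfl]; exact hj)
      simpa only [shiftPerm_mul_simpleTransposition_self, skip_lt_self_iff, le_skip_iff,
        lt_irrefl, if_false, (skip_strictMono k).le_iff_le] using hk
    · simpa only [shiftPerm_mul_simpleTransposition_skip σ hk, (skip_strictMono i).lt_iff_lt,
        (skip_strictMono i).le_iff_le] using h.between hj

theorem IsBackward.shiftPerm_mul (hdup : β i = β (i + 1)) (h : IsBackward (β ∘ skip i) σ) :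
    IsBackward β (shiftPerm i σ * simpleTransposition i) := by
  have hii : skip i i = i + 1 := skip_of_le le_rfl
  have hself := shiftPerm_mul_simpleTransposition_self i σ
  have hsucc := shiftPerm_mul_simpleTransposition_succ i σ
  have hskip {k : ℕ} (hk : k ≠ i) := shiftPerm_mul_simpleTransposition_skip σ hk
  have hle (k : ℕ) : i ≤ skip i k ↔ i ≤ k := by simp [le_skip_iff]
  have hle' {k : ℕ} (hk : k ≠ i) : skip i k ≤ i ↔ k ≤ i := by
    rw [(skip_ne i k).le_iff_lt, skip_lt_self_iff, hk.le_iff_lt]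
  have happ (k : ℕ) : β (skip i (σ k)) = β (skip i k) := h.label_apply k
  have hdup' : β (skip i i) = β i := by rw [hii, hdup]
  refine ⟨fun k => ?_, fun {j k} hj => ?_⟩
  · rcases eq_or_eq_skip i k with rfl | ⟨k, rfl⟩
    · rw [hself, happ, hdup']
    · rcases eq_or_ne k i with rfl | hk
      · rw [hii, hsucc, hdup]
      · rw [hskip hk, happ]
  · rcases eq_or_eq_skip i k with rfl | ⟨k, rfl⟩
    · rw [hself, skip_lt_self_iff]
      rcases eq_or_eq_skip k j with rfl | ⟨j, rfl⟩
      · rw [hle]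
        omega
      · simpa only [(skip_strictMono k).le_iff_le, hle] using h.between (hj.trans hdup'.symm)
    · rcases eq_or_ne k i with rfl | hk
      · rw [hii, hsucc]
        omega
      · rw [hskip hk, (skip_strictMono i).lt_iff_lt]
        rcases eq_or_eq_skip i j with rfl | ⟨j, rfl⟩
        · rw [hle, hle' hk]
          exact h.between (hdup'.trans hj)
        · simpa only [(skip_strictMono i).le_iff_le] using h.between hj

end Labelling

section NoncrossingPerms

variable {n i k : ℕ} {σ : Equiv.Perm ℕ}

theorem one_mem_noncrossingPerms (n : ℕ) : 1 ∈ noncrossingPerms n := by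
  have hid : IsNCLabelling n (id : ℕ → ℕ) :=
    ⟨fun _ _ _ _ hac hcb _ hab _ => absurd hab (hac.trans hcb).ne, fun _ h => h⟩
  exact hid.mem_noncrossingPerms ⟨fun _ => rfl, fun hj => .inr ⟨hj.ge, hj.le⟩⟩

theorem shiftPerm_mem_noncrossingPerms (h : σ ∈ noncrossingPerms n) (hi : i ≤ n) :
    shiftPerm i σ ∈ noncrossingPerms (n + 1) := by
  obtain ⟨β, hβ, hσ⟩ := exists_isNCLabelling h
  have hskip := (skip_strictMono i).injective
  let γ : ℕ → Option ℕ := Function.extend (skip i) (some ∘ β) fun _ => none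
  have hγ : γ ∘ skip i = some ∘ β := Function.extend_comp hskip _ _
  have hiso (j : ℕ) (hj : γ j = γ i) : j = i := by
    rcases eq_or_eq_skip i j with rfl | ⟨j, rfl⟩
    · rfl
    · have hnone : γ i = none := Function.extend_apply' _ _ _ fun ⟨k, hk⟩ => skip_ne i k hk
      have hsome : γ (skip i j) = some (β j) := congrFun hγ j
      rw [hsome, hnone] at hj
      exact absurd hj (Option.some_ne_none _)
  refine IsNCLabelling.mem_noncrossingPerms (β := γ) (.of_isolated ?_ hi hiso)
    ((isBackward_shiftPerm_iff hiso).2 ?_)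
  · exact hγ ▸ hβ.comp_injective (Option.some_injective _)
  · exact hγ ▸ hσ.comp_injective (Option.some_injective _)

theorem shiftPerm_mul_simpleTransposition_mem_noncrossingPerms (h : σ ∈ noncrossingPerms n)
    (hi : i < n) : shiftPerm i σ * simpleTransposition i ∈ noncrossingPerms (n + 1) := by
  obtain ⟨β, hβ, hσ⟩ := exists_isNCLabelling h
  have hskip := (skip_strictMono i).injective
  let γ : ℕ → ℕ := Function.extend (skip i) β fun _ => β i
  have hγ : γ ∘ skip i = β := Function.extend_comp hskip _ _
  have hdup : γ i = γ (i + 1) := by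
    rw [← skip_of_le le_rfl]
    exact (Function.extend_apply' _ _ _ fun ⟨k, hk⟩ => skip_ne i k hk).trans (congrFun hγ i).symm
  exact IsNCLabelling.mem_noncrossingPerms (.of_doubled (hγ.symm ▸ hβ) hi hdup)
    (.shiftPerm_mul hdup (hγ.symm ▸ hσ))

theorem insertDesc_mem_noncrossingPerms (h : σ ∈ noncrossingPerms n) (hi : i < n) :
    insertDesc i σ ∈ noncrossingPerms (n + 1) := by
  unfold insertDesc
  split_ifs
  · exact shiftPerm_mem_noncrossingPerms h hi.le
  · exact shiftPerm_mul_simpleTransposition_mem_noncrossingPerms h hi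

theorem insertAsc_mem_noncrossingPerms (h : σ ∈ noncrossingPerms n) (hi : i < n) :
    insertAsc i σ ∈ noncrossingPerms (n + 1) := by
  unfold insertAsc
  split_ifs
  · exact shiftPerm_mul_simpleTransposition_mem_noncrossingPerms h hi
  · exact shiftPerm_mem_noncrossingPerms h hi.le

theorem apply_eq_self_of_mem_noncrossingPerms (h : σ ∈ noncrossingPerms n) (hk : n ≤ k) :
    σ k = k := by
  obtain ⟨β, hβ, hσ⟩ := exists_isNCLabelling h
  exact hβ.eq_of_le hk (hσ.label_apply k)

theorem isolated_of_descent {α : Type*} {β : ℕ → α} (hβ : Noncrossing β) (hσ : IsBackward β σ)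
    (h1 : i ≤ σ i) (h2 : σ (i + 1) < i) (j : ℕ) (hj : β j = β i) : j = i := by
  have hlab := hσ.label_apply (i + 1)
  have hne : β i ≠ β (i + 1) := fun he => by
    have := hσ.between (hlab.trans he.symm)
    omega
  have hsucc : σ i ≠ i + 1 := fun he => hne (by rw [← he, hσ.label_apply])
  have hfix : σ i = i := by
    by_contra hi
    exact hne ((hβ h2 (Nat.lt_succ_self i) (by omega) hlab (hσ.label_apply i).symm).symm.trans hlab)
  have := hσ.between hj
  omega

theorem exists_eq_insertDesc (h : σ ∈ noncrossingPerms n) (h1 : i ≤ σ i) (h2 : σ (i + 1) ≤ i) :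
    ∃ m, n = m + 1 ∧ i < m ∧ ∃ τ ∈ noncrossingPerms m, σ = insertDesc i τ := by
  have hin : i + 1 < n := lt_of_not_ge fun hn => by
    have := apply_eq_self_of_mem_noncrossingPerms h hn
    omega
  obtain ⟨m, rfl⟩ : ∃ m, n = m + 1 := ⟨n - 1, by omega⟩
  refine ⟨m, rfl, by omega, ?_⟩
  obtain ⟨β, hβ, hσ⟩ := exists_isNCLabelling h
  have hβ' : IsNCLabelling m (β ∘ skip i) := hβ.comp_skip (by omega)
  rcases h2.eq_or_lt with h2 | h2
  · obtain ⟨τ, hτ⟩ := exists_eq_shiftPerm (i := i) (τ := σ * simpleTransposition i) (by simpa)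
    obtain rfl : σ = shiftPerm i τ * simpleTransposition i := by
      rw [← hτ, mul_assoc, simpleTransposition_mul_self, mul_one]
    have hdup : β i = β (i + 1) := by
      rw [← hσ.label_apply (i + 1), shiftPerm_mul_simpleTransposition_succ]
    refine ⟨τ, hβ'.mem_noncrossingPerms (hσ.of_shiftPerm_mul hdup), ?_⟩
    rw [shiftPerm_mul_simpleTransposition_self, ← not_lt, skip_lt_self_iff] at h1
    rw [insertDesc, if_neg h1]
  · have hiso := isolated_of_descent hβ.noncrossing hσ h1 h2
    obtain ⟨τ, rfl⟩ := exists_eq_shiftPerm (hiso _ (hσ.label_apply i))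
    refine ⟨τ, hβ'.mem_noncrossingPerms ((isBackward_shiftPerm_iff hiso).1 hσ), ?_⟩
    rw [shiftPerm_succ_of_le τ le_rfl, skip_lt_self_iff] at h2
    rw [insertDesc, if_pos h2]

theorem exists_descent (h : σ ∈ noncrossingPerms n) (h1 : σ ≠ 1) :
    ∃ i, i ≤ σ i ∧ σ (i + 1) ≤ i := by
  obtain ⟨β, -, hσ⟩ := exists_isNCLabelling h
  obtain ⟨a, ha⟩ : ∃ a, a < σ a := by
    by_contra! h
    exact h1 (eq_one_of_forall_le h)
  have hex : ∃ k, a < k ∧ σ k < k := by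
    have := hσ.between (hσ.label_apply a).symm
    exact ⟨σ a, ha, by omega⟩
  obtain ⟨h2, h3⟩ := Nat.find_spec hex
  obtain ⟨i, hi⟩ : ∃ i, Nat.find hex = i + 1 := ⟨Nat.find hex - 1, by omega⟩
  rw [hi] at h2 h3
  refine ⟨i, ?_, by omega⟩
  rcases Nat.lt_succ_iff_lt_or_eq.1 h2 with h4 | rfl
  · exact not_lt.1 fun h5 => Nat.find_min hex (m := i) (by omega) ⟨h4, h5⟩
  · exact ha.le

theorem sum_diagRank_insertAsc_lt (hi : i < n) (σ : Equiv.Perm ℕ) :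
    ∑ m ∈ Finset.range (2 * n + 1), diagRank (insertAsc i σ) m <
      ∑ m ∈ Finset.range (2 * n + 1), diagRank (insertDesc i σ) m := by
  have hdiag := diagRank_two_mul_add_one_eq σ i
  refine Finset.sum_lt_sum (fun m _ => rankLE_insertAsc_insertDesc i σ m) ?_
  split_ifs at hdiag
  · refine ⟨2 * i + 2, Finset.mem_range.2 (by omega), ?_⟩
    rw [diagRank_insertAsc_two_mul_add_two, diagRank_insertDesc_two_mul_add_two]
    omega
  · refine ⟨2 * i + 1, Finset.mem_range.2 (by omega), ?_⟩
    rw [diagRank_insertAsc_two_mul_add_one, diagRank_insertDesc_two_mul_add_one]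
    omega

@[elab_as_elim]
theorem noncrossingPerms_induction
    {motive : (n : ℕ) → (σ : Equiv.Perm ℕ) → σ ∈ noncrossingPerms n → Prop}
    (one : ∀ n, motive n 1 (one_mem_noncrossingPerms n))
    (insert : ∀ n σ i (hσ : σ ∈ noncrossingPerms n) (hi : i < n), motive n σ hσ →
      motive (n + 1) (insertAsc i σ) (insertAsc_mem_noncrossingPerms hσ hi) →
      motive (n + 1) (insertDesc i σ) (insertDesc_mem_noncrossingPerms hσ hi))
    (h : σ ∈ noncrossingPerms n) : motive n σ h := by
  induction n using Nat.strong_induction_on generalizing σ with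
  | _ n ihn =>
    induction hs : ∑ m ∈ Finset.range (2 * n + 1), diagRank σ m
      using Nat.strong_induction_on generalizing σ with
    | _ s ihs =>
      by_cases h1 : σ = 1
      · subst h1; exact one n
      obtain ⟨i, h2, h3⟩ := exists_descent h h1
      obtain ⟨m, rfl, hi, τ, hτ, rfl⟩ := exists_eq_insertDesc h h2 h3
      exact insert m τ i hτ hi (ihn m (Nat.lt_succ_self m) hτ)
        (ihs _ (hs ▸ sum_diagRank_insertAsc_lt (by omega) τ) (insertAsc_mem_noncrossingPerms hτ hi)
          rfl)

end NoncrossingPerms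

/-! ### The noncrossing permutation of a tree -/

section TreePerm

variable {B : Finset ℕ} {T : BinaryTree Unit} {b : Bool} {i j k : ℕ} {σ : Equiv.Perm ℕ}

theorem backwardCycle_singleton (k : ℕ) : backwardCycle {k} = 1 := by
  simp [backwardCycle]

theorem backwardCycle_insert {m z : ℕ} (hm : m ∈ B) (hmax : ∀ b ∈ B, b ≤ m) (hz : m < z) :
    backwardCycle (insert z B) = Equiv.swap z m * backwardCycle B := by
  have hzB : z ∉ B := fun h => (hmax z h).not_gt hz
  have hB : B.sort (· ≥ ·) = m :: (B.erase m).sort (· ≥ ·) := by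
    conv_lhs => rw [← Finset.insert_erase hm]
    exact Finset.sort_insert _ (fun b hb => hmax b (Finset.mem_of_mem_erase hb))
      (Finset.notMem_erase m B)
  rw [backwardCycle, backwardCycle,
    Finset.sort_insert _ (fun b hb => (hmax b hb).trans hz.le) hzB, hB, List.formPerm_cons_cons]

theorem blocksPerm_append (L M : List (Finset ℕ)) :
    blocksPerm (L ++ M) = blocksPerm L * blocksPerm M := by
  simp [blocksPerm]

theorem blocksPerm_filter {L : List (Finset ℕ)} {p : Finset ℕ → Prop} [DecidablePred p]
    (h : ∀ B ∈ L, ¬ p B → backwardCycle B = 1) : blocksPerm (L.filter (p ·)) = blocksPerm L := by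
  induction L with
  | nil => rfl
  | cons B L ih =>
    rw [List.forall_mem_cons] at h
    rw [List.filter_cons]
    split_ifs with hB
    · rw [blocksPerm_cons, blocksPerm_cons, ih h.2]
    · rw [blocksPerm_cons, ih h.2, h.1 (by simpa using hB), one_mul]

theorem leaves_cutLeftEdges_subset (b : Bool) (T : BinaryTree Unit) (k : ℕ) :
    ∀ S ∈ (cutLeftEdges b (labelTree T k)).1 :: (cutLeftEdges b (labelTree T k)).2,
      S.leaves ⊆ Finset.Ico k (k + T.numLeaves) := by
  induction T generalizing b k with
  | nil => simp [labelTree, cutLeftEdges, LabelledTree.leaves]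
  | node _ l r ihl ihr =>
    rw [numLeaves_node]
    have hl := fun S hS => (ihl false k S hS).trans
      (Finset.Ico_subset_Ico_right (by omega : _ ≤ k + (l.numLeaves + r.numLeaves)))
    have hr := fun S hS => (ihr true (k + l.numLeaves) S hS).trans
      (Finset.Ico_subset_Ico (by omega : k ≤ _)
        (by omega : _ ≤ k + (l.numLeaves + r.numLeaves)))
    rw [List.forall_mem_cons] at hl hr
    cases b <;> simp only [labelTree, cutLeftEdges, LabelledTree.leaves, List.forall_mem_cons,
      List.forall_mem_append, Finset.union_subset_iff]
    · exact ⟨⟨hl.1, hr.1⟩, hl.2, hr.2⟩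
    · exact ⟨hr.1, hl.1, hl.2, hr.2⟩

theorem leaves_cutLeftEdges_true (T : BinaryTree Unit) (k : ℕ) :
    (cutLeftEdges true (labelTree T k)).1.leaves = {k + T.numLeaves - 1} := by
  induction T generalizing k with
  | nil => rfl
  | node _ l r _ ihr => rw [labelTree, cutLeftEdges, ihr, numLeaves_node, add_assoc]

theorem last_mem_leaves_cutLeftEdges_false (T : BinaryTree Unit) (k : ℕ) :
    k + T.numLeaves - 1 ∈ (cutLeftEdges false (labelTree T k)).1.leaves := by
  cases T with
  | nil => exact Finset.mem_singleton_self _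
  | node _ l r =>
    rw [labelTree, cutLeftEdges, LabelledTree.leaves, leaves_cutLeftEdges_true, numLeaves_node,
      add_assoc]
    exact Finset.mem_union_right _ (Finset.mem_singleton_self _)

/-- The product of the backwards cycles of the blocks of a tree with leaves `k, k + 1, …`. If the
root is a right child (`b = true`), the block of the last leaf extends beyond the tree and is left
out. -/
def treePerm (b : Bool) (T : BinaryTree Unit) (k : ℕ) : Equiv.Perm ℕ :=
  blocksPerm (((if b then [] else [(cutLeftEdges b (labelTree T k)).1]) ++
    (cutLeftEdges b (labelTree T k)).2).map LabelledTree.leaves)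

theorem treePerm_nil (b : Bool) (k : ℕ) : treePerm b .nil k = 1 := by
  cases b <;> simp [treePerm, labelTree, cutLeftEdges, LabelledTree.leaves, blocksPerm,
    backwardCycle_singleton]

theorem treePerm_true_node (l r : BinaryTree Unit) (k : ℕ) :
    treePerm true (.node () l r) k = treePerm false l k * treePerm true r (k + l.numLeaves) := by
  simp [treePerm, labelTree, cutLeftEdges, blocksPerm_cons, blocksPerm_append, mul_assoc]

theorem treePerm_false_node (l r : BinaryTree Unit) (k : ℕ) :
    treePerm false (.node () l r) k =
      Equiv.swap (k + l.numLeaves + r.numLeaves - 1) (k + l.numLeaves - 1) *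
        treePerm true (.node () l r) k := by
  have hl := l.numLeaves_pos
  have hr := r.numLeaves_pos
  have hmax (b : ℕ) (hb : b ∈ (cutLeftEdges false (labelTree l k)).1.leaves) :
      b ≤ k + l.numLeaves - 1 := by
    have := Finset.mem_Ico.1 (leaves_cutLeftEdges_subset false l k _ List.mem_cons_self hb)
    omega
  have hinsert := backwardCycle_insert (z := k + l.numLeaves + r.numLeaves - 1)
    (last_mem_leaves_cutLeftEdges_false l k) hmax (by omega)
  simp [treePerm, labelTree, cutLeftEdges, LabelledTree.leaves, leaves_cutLeftEdges_true,
    blocksPerm_cons, blocksPerm_append, Finset.union_singleton, hinsert, mul_assoc]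

theorem treePerm_of_lt_or_le (h : j < k ∨ k + T.numLeaves ≤ j) : treePerm b T k j = j := by
  refine blocksPerm_of_notMem fun B hB hj => ?_
  obtain ⟨S, hS, rfl⟩ := List.mem_map.1 hB
  have hS : S ∈ (cutLeftEdges b (labelTree T k)).1 :: (cutLeftEdges b (labelTree T k)).2 := by
    cases b
    · simpa using hS
    · exact List.mem_cons_of_mem _ (by simpa using hS)
  have := Finset.mem_Ico.1 (leaves_cutLeftEdges_subset b T k S hS hj)
  omega

theorem treePerm_bounds (b : Bool) (h1 : k ≤ j) (h2 : j < k + T.numLeaves) :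
    k ≤ treePerm b T k j ∧ treePerm b T k j < k + T.numLeaves := by
  by_contra h
  have := (treePerm b T k).injective
    (treePerm_of_lt_or_le (b := b) (T := T) (j := treePerm b T k j) (by omega))
  omega

theorem treePerm_true_last (T : BinaryTree Unit) (k : ℕ) :
    treePerm true T k (k + T.numLeaves - 1) = k + T.numLeaves - 1 := by
  induction T generalizing k with
  | nil => rw [treePerm_nil, Equiv.Perm.one_apply]
  | node _ l r _ ihr =>
    have hr := r.numLeaves_pos
    rw [treePerm_true_node, numLeaves_node, Equiv.Perm.mul_apply, ← add_assoc, ihr,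
      treePerm_of_lt_or_le (.inr (by omega))]

theorem treePerm_succ (h : i ≤ k) (b : Bool) (T : BinaryTree Unit) :
    treePerm b T (k + 1) = shiftPerm i (treePerm b T k) := by
  induction T generalizing k b with
  | nil => rw [treePerm_nil, treePerm_nil, map_one]
  | node _ l r ihl ihr =>
    have hl := l.numLeaves_pos
    have htrue : treePerm true (.node () l r) (k + 1) =
        shiftPerm i (treePerm true (.node () l r) k) := by
      rw [treePerm_true_node, treePerm_true_node, map_mul, ihl h, add_right_comm, ihr (by omega)]
    cases b
    · rw [treePerm_false_node, treePerm_false_node, map_mul, htrue, shiftPerm_swap,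
        skip_of_le (by omega), skip_of_le (by omega)]
      congr 2 <;> omega
    · exact htrue

theorem shiftPerm_treePerm (b : Bool) (h : k + T.numLeaves ≤ i) :
    shiftPerm i (treePerm b T k) = treePerm b T k := by
  refine (eq_shiftPerm (treePerm_of_lt_or_le (.inr h)) fun j => ?_).symm
  by_cases hj : k ≤ j ∧ j < k + T.numLeaves
  · have := treePerm_bounds b hj.1 hj.2
    rw [skip_of_lt (by omega), skip_of_lt (by omega)]
  · have hskip : skip i j < k ∨ k + T.numLeaves ≤ skip i j := by
      unfold skip; split_ifs <;> omega
    rw [treePerm_of_lt_or_le hskip, treePerm_of_lt_or_le (by omega)]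

/-- Whether the leaf `i` of a tree with leaves `k, k + 1, …` is a right child. The first argument
says whether the root of the tree is one. -/
def isRightLeaf (i : ℕ) : Bool → BinaryTree Unit → ℕ → Bool
  | b, .nil, _ => b
  | _, .node _ l r, k =>
      if i < k + l.numLeaves then isRightLeaf i false l k
      else isRightLeaf i true r (k + l.numLeaves)

theorem isRightLeaf_iff (hi : k ≤ i) (hi' : i < k + T.numLeaves) :
    isRightLeaf i b T k ↔ b ∧ i + 1 = k + T.numLeaves ∨ treePerm b T k i < i := by
  induction T generalizing b k with
  | nil =>
    rw [numLeaves_nil] at hi' ⊢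
    simp [isRightLeaf, treePerm_nil, show i = k by omega]
  | node _ l r ihl ihr =>
    have hl := l.numLeaves_pos
    have hr := r.numLeaves_pos
    rw [numLeaves_node] at hi' ⊢
    rcases lt_or_ge i (k + l.numLeaves) with h | h
    · have happ : treePerm true (.node () l r) k i = treePerm false l k i := by
        rw [treePerm_true_node, Equiv.Perm.mul_apply, treePerm_of_lt_or_le (.inl h)]
      have hbounds := treePerm_bounds false hi h
      rw [isRightLeaf, if_pos h, ihl hi h]
      cases b
      · rw [treePerm_false_node, Equiv.Perm.mul_apply, happ, Equiv.swap_apply_def]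
        simp only [Bool.false_eq_true, false_and, false_or]
        split_ifs <;> omega
      · rw [happ]
        simp only [Bool.false_eq_true, false_and, false_or]
        omega
    · have hbounds := treePerm_bounds true (T := r) h (by omega)
      have happ : treePerm true (.node () l r) k i = treePerm true r (k + l.numLeaves) i := by
        rw [treePerm_true_node, Equiv.Perm.mul_apply, treePerm_of_lt_or_le (.inr hbounds.1)]
      have hlast : treePerm true r (k + l.numLeaves) i = k + l.numLeaves + r.numLeaves - 1 ↔
          i = k + l.numLeaves + r.numLeaves - 1 := by
        conv_lhs => rw [← treePerm_true_last r, (Equiv.injective _).eq_iff]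
      rw [isRightLeaf, if_neg h.not_gt, ihr h (by omega)]
      cases b
      · rw [treePerm_false_node, Equiv.Perm.mul_apply, happ, Equiv.swap_apply_def]
        simp only [Bool.false_eq_true, false_and, false_or, true_and]
        split_ifs <;> omega
      · rw [happ, add_assoc]

theorem treePerm_node_eq_shiftPerm_mul {l r l' r' : BinaryTree Unit}
    (htrue : treePerm true (.node () l' r') k = shiftPerm i (treePerm true (.node () l r) k) * σ)
    (hlast : k + l'.numLeaves + r'.numLeaves - 1 = skip i (k + l.numLeaves + r.numLeaves - 1))
    (hleft : k + l'.numLeaves - 1 = skip i (k + l.numLeaves - 1)) (b : Bool) :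
    treePerm b (.node () l' r') k = shiftPerm i (treePerm b (.node () l r) k) * σ := by
  cases b
  · rw [treePerm_false_node, treePerm_false_node, htrue, map_mul, shiftPerm_swap, hlast, hleft,
      mul_assoc]
  · exact htrue

/-- Grafting at a right leaf makes the new leaf a singleton block; at any other leaf it doubles
the leaf inside its block. -/
theorem treePerm_graftTree (b : Bool) (hi : k ≤ i) (hi' : i < k + T.numLeaves) :
    treePerm b (graftTree i T k) k = shiftPerm i (treePerm b T k) *
      if isRightLeaf i b T k then 1 else simpleTransposition i := by
  induction T generalizing b k with
  | nil =>
    obtain rfl : k = i := by rw [numLeaves_nil] at hi'; omega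
    rw [graftTree_nil_self]
    cases b <;> simp [treePerm_nil, treePerm_true_node, treePerm_false_node,
      isRightLeaf, simpleTransposition, Equiv.swap_comm]
  | node _ l r ihl ihr =>
    have hl := l.numLeaves_pos
    have hr := r.numLeaves_pos
    rw [numLeaves_node] at hi'
    rcases lt_or_ge i (k + l.numLeaves) with h | h
    · have hcomm := simpleTransposition_commute_shiftPerm (σ := treePerm true r (k + l.numLeaves))
        (treePerm_of_lt_or_le (.inl h))
      rw [graftTree_node_of_lt h, isRightLeaf, if_pos h]
      refine treePerm_node_eq_shiftPerm_mul ?_ ?_ ?_ b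
      · rw [treePerm_true_node, treePerm_true_node, map_mul, ihl false hi h,
          numLeaves_graftTree hi h, ← add_assoc, treePerm_succ h.le, mul_assoc, mul_assoc]
        split_ifs
        · rw [one_mul, mul_one]
        · rw [hcomm.eq]
      · rw [numLeaves_graftTree hi h, skip_of_le (by omega)]
        omega
      · rw [numLeaves_graftTree hi h, skip_of_le (by omega)]
        omega
    · rw [graftTree_node_of_le h, isRightLeaf, if_neg h.not_gt]
      refine treePerm_node_eq_shiftPerm_mul ?_ ?_ ?_ b
      · rw [treePerm_true_node, treePerm_true_node, map_mul, ihr true h (by omega),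
          shiftPerm_treePerm false h, mul_assoc]
      · rw [numLeaves_graftTree h (by omega), skip_of_le (by omega)]
        omega
      · rw [skip_of_lt (by omega)]

theorem treePerm_false_graftTree (hi : k ≤ i) (hi' : i < k + T.numLeaves) :
    treePerm false (graftTree i T k) k = insertDesc i (treePerm false T k) := by
  have hiff := isRightLeaf_iff (b := false) hi hi'
  simp only [Bool.false_eq_true, false_and, false_or] at hiff
  rw [treePerm_graftTree false hi hi', insertDesc, if_congr hiff rfl rfl]
  split_ifs
  · rw [mul_one]
  · rfl

end TreePerm

/-! ### The noncrossing permutation of a forest -/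

namespace IndexedForest

variable {n m i : ℕ} {F G : IndexedForest} {σ : Equiv.Perm ℕ}

/-- The product of the noncrossing permutations of the first `N` trees. -/
def partialPerm (F : IndexedForest) (N : ℕ) : Equiv.Perm ℕ :=
  blocksPerm (((List.range N).flatMap F.lcTrees).map LabelledTree.leaves)

theorem partialPerm_zero (F : IndexedForest) : F.partialPerm 0 = 1 := rfl

theorem partialPerm_succ (F : IndexedForest) (N : ℕ) :
    F.partialPerm (N + 1) = F.partialPerm N * treePerm false (F.tree N) (F.start N) := by
  rw [partialPerm, List.range_succ, List.flatMap_append, List.map_append, blocksPerm_append,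
    List.flatMap_singleton, partialPerm]
  rfl

theorem partialPerm_of_le (F : IndexedForest) {N k : ℕ} (h : F.start N ≤ k) :
    F.partialPerm N k = k := by
  induction N with
  | zero => rfl
  | succ N ih =>
    have := F.start_succ N
    rw [partialPerm_succ, Equiv.Perm.mul_apply, treePerm_of_lt_or_le (.inr (by omega)),
      ih (by omega)]

theorem partialPerm_graft_of_le (F : IndexedForest) {N : ℕ} (h : F.start N ≤ i) :
    (F.graft i).partialPerm N = shiftPerm i (F.partialPerm N) := by
  induction N with
  | zero => rw [partialPerm_zero, partialPerm_zero, map_one]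
  | succ N ih =>
    have hs := F.start_succ N
    rw [partialPerm_succ, partialPerm_succ, map_mul, ih (by omega), start_graft_of_le (by omega),
      tree_graft_of_start_succ_le h, shiftPerm_treePerm false (by omega)]

theorem partialPerm_graft_of_lt (F : IndexedForest) {N : ℕ} (h : i < F.start N) :
    (F.graft i).partialPerm N = insertDesc i (F.partialPerm N) := by
  induction N with
  | zero => simp at h
  | succ N ih =>
    have hs := F.start_succ N
    rw [partialPerm_succ, partialPerm_succ]
    rcases lt_or_ge i (F.start N) with h' | h'
    · rw [ih h', start_graft_of_lt h', tree_graft_of_lt_start h', treePerm_succ h'.le,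
        insertDesc_mul_of_apply_eq]
      exact treePerm_of_lt_or_le (.inl h')
    · rw [partialPerm_graft_of_le F h', start_graft_of_le h', tree_graft,
        treePerm_false_graftTree h' (by omega), insertDesc_mul_of_apply_apply_eq]
      exact F.partialPerm_of_le (treePerm_bounds false h' (by omega)).1

theorem tree_eq_nil_of_mem_forestsOn (hF : F ∈ forestsOn n) (h : n ≤ m) : F.tree m = .nil := by
  by_contra hne
  have := mem_forestsOn_iff.1 hF m hne
  have := F.le_start (m + 1)
  omega

theorem forToNC_eq_partialPerm (hF : F ∈ forestsOn n) : F.forToNC n = F.partialPerm n := by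
  refine blocksPerm_filter fun B hB hsub => ?_
  obtain ⟨T, hT, rfl⟩ := List.mem_map.1 hB
  obtain ⟨j, -, hj⟩ := List.mem_flatMap.1 hT
  by_cases hnil : F.tree j = .nil
  · rw [lcTrees, hnil] at hj
    simp only [labelTree, cutLeftEdges, List.mem_cons, List.not_mem_nil, or_false] at hj
    rw [hj, LabelledTree.leaves, backwardCycle_singleton]
  · refine absurd (fun b hb => ?_) hsub
    have hb := Finset.mem_Ico.1 (leaves_cutLeftEdges_subset false _ _ _ hj hb)
    rw [← F.start_succ] at hb
    exact Finset.mem_range.2 (hb.2.trans_le (mem_forestsOn_iff.1 hF j hnil))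

theorem forToNC_empty (n : ℕ) : empty.forToNC n = 1 := by
  rw [forToNC_eq_partialPerm (empty_mem_forestsOn n)]
  induction n with
  | zero => rfl
  | succ n ih => rw [partialPerm_succ, ih, one_mul]; exact treePerm_nil false _

theorem forToNC_graft (hF : F ∈ forestsOn n) (hi : i < n) :
    (F.graft i).forToNC (n + 1) = insertDesc i (F.forToNC n) := by
  have := F.le_start (n + 1)
  rw [forToNC_eq_partialPerm (graft_mem_forestsOn_iff.2 ⟨hF, hi⟩), forToNC_eq_partialPerm hF,
    partialPerm_graft_of_lt F (by omega), partialPerm_succ,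
    tree_eq_nil_of_mem_forestsOn hF le_rfl, treePerm_nil, mul_one]

theorem exists_of_graft_mem_forestsOn (h : F.graft i ∈ forestsOn n) :
    ∃ m, n = m + 1 ∧ F ∈ forestsOn m ∧ i < m := by
  cases n with
  | zero =>
    have h' : F.graft i ∈ forestsOn 1 := fun _ hk => Nat.lt_succ_of_lt (h hk)
    exact absurd (graft_mem_forestsOn_iff.1 h').2 (Nat.not_lt_zero i)
  | succ m => exact ⟨m, rfl, graft_mem_forestsOn_iff.1 h⟩

@[elab_as_elim]
theorem forestsOn_induction {motive : (n : ℕ) → (F : IndexedForest) → F ∈ forestsOn n → Prop}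
    (empty : ∀ n, motive n .empty (empty_mem_forestsOn n))
    (graft : ∀ n F i (hF : F ∈ forestsOn n) (hi : i < n), motive n F hF →
      motive (n + 1) (F.graft i) (graft_mem_forestsOn_iff.2 ⟨hF, hi⟩))
    (hF : F ∈ forestsOn n) : motive n F hF := by
  induction F using graft_induction generalizing n with
  | empty => exact empty n
  | graft F i ih =>
    obtain ⟨m, rfl, hG, hi⟩ := exists_of_graft_mem_forestsOn hF
    exact graft m F i hG hi (ih hG)

theorem forToNC_mem_noncrossingPerms (hF : F ∈ forestsOn n) :
    F.forToNC n ∈ noncrossingPerms n := by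
  induction hF using forestsOn_induction with
  | empty n => rw [forToNC_empty]; exact one_mem_noncrossingPerms n
  | graft n F i hF hi ih =>
    rw [forToNC_graft hF hi]
    exact insertDesc_mem_noncrossingPerms ih hi

theorem mem_qDes_iff (hF : F ∈ forestsOn n) :
    i ∈ F.qDes ↔ i ≤ F.forToNC n i ∧ F.forToNC n (i + 1) ≤ i := by
  constructor
  · intro hi
    rw [← graft_trim hi] at hF ⊢
    obtain ⟨m, rfl, hG, him⟩ := exists_of_graft_mem_forestsOn hF
    rw [forToNC_graft hG him]
    exact ⟨le_insertDesc_self i _, insertDesc_succ_le i _⟩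
  · rintro ⟨h1, h2⟩
    induction hF using forestsOn_induction generalizing i with
    | empty n => rw [forToNC_empty, Equiv.Perm.one_apply] at h2; omega
    | graft n F j hF hj ih =>
      rw [forToNC_graft hF hj] at h1 h2
      rcases eq_or_ne i j with rfl | hij
      · exact mem_qDes_graft F i
      obtain ⟨m, hm, rfl, hm1, hm2⟩ := exists_descent_of_insertDesc hij h1 h2
      rw [← graft_trim (ih hm1 hm2)]
      rcases hm with hm | hm
      · obtain ⟨a, rfl⟩ : ∃ a, j = a + 1 := ⟨j - 1, by omega⟩
        rw [skip_of_lt (by omega), ← graft_graft _ (by omega)]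
        exact mem_qDes_graft _ _
      · rw [skip_of_le hm.le, graft_graft _ hm]
        exact mem_qDes_graft _ _

theorem forToNC_injOn (n : ℕ) : Set.InjOn (forToNC n) (forestsOn n) := by
  intro F hF
  induction hF using forestsOn_induction with
  | empty n =>
    intro G hG h
    by_contra! hne
    obtain ⟨i, hi⟩ := exists_mem_qDes hne.symm
    have := ((mem_qDes_iff hG).1 hi).2
    rw [← h, forToNC_empty, Equiv.Perm.one_apply] at this
    omega
  | graft n F i hF hi ih =>
    intro G hG h
    have hiG : i ∈ G.qDes := by
      rw [mem_qDes_iff hG, ← h, ← mem_qDes_iff (graft_mem_forestsOn_iff.2 ⟨hF, hi⟩)]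
      exact mem_qDes_graft F i
    rw [← graft_trim hiG] at hG h ⊢
    have hG' := (graft_mem_forestsOn_iff.1 hG).1
    rw [forToNC_graft hF hi, forToNC_graft hG' hi] at h
    rw [ih hG' (insertDesc_injective i h)]

theorem exists_forToNC_eq (h : σ ∈ noncrossingPerms n) : ∃ F ∈ forestsOn n, F.forToNC n = σ := by
  induction n using Nat.strong_induction_on generalizing σ with
  | _ n ih =>
    by_cases h1 : σ = 1
    · exact ⟨empty, empty_mem_forestsOn n, by rw [h1, forToNC_empty]⟩
    obtain ⟨i, h2, h3⟩ := exists_descent h h1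
    obtain ⟨m, rfl, hi, τ, hτ, rfl⟩ := exists_eq_insertDesc h h2 h3
    obtain ⟨G, hG, rfl⟩ := ih m (Nat.lt_succ_self m) hτ
    exact ⟨G.graft i, graft_mem_forestsOn_iff.2 ⟨hG, hi⟩, forToNC_graft hG hi⟩

theorem bijOn_forToNC (n : ℕ) : Set.BijOn (forToNC n) (forestsOn n) (noncrossingPerms n) :=
  ⟨fun _ hF => forToNC_mem_noncrossingPerms hF, forToNC_injOn n, fun _ hσ => exists_forToNC_eq hσ⟩

end IndexedForest

/-! ### Evaluations at noncrossing permutations -/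

section EvInsert

variable {i : ℕ} {f g : PolTX}

/-- The evaluation of the variables `x` at `t_{σ(0)}, t_{σ(1)}, …` with the parameter `t_i` skipped,
while the parameters of the polynomial itself are kept. -/
noncomputable def evSkip (i : ℕ) (σ : Equiv.Perm ℕ) : PolTX →ₐ[ℤ] MvPolynomial ℕ ℤ :=
  aeval (Sum.elim (fun k => X (skip i (σ k))) X)

@[simp] theorem evSkip_x (i : ℕ) (σ : Equiv.Perm ℕ) (j : ℕ) :
    evSkip i σ (x j) = X (skip i (σ j)) := by simp [evSkip, x]

@[simp] theorem evSkip_t (i : ℕ) (σ : Equiv.Perm ℕ) (j : ℕ) : evSkip i σ (t j) = X j := by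
  simp [evSkip, t]

theorem insertT_x_skip (i a k : ℕ) : insertT i a (x (skip i k)) = x k := by
  rcases lt_or_ge k i with h | h
  · rw [skip_of_lt h, insertT_x_of_lt a h]
  · rw [skip_of_le h, insertT_x_succ_of_le a h]

theorem evSkip_comp_insertT {p : ℕ} {σ τ : Equiv.Perm ℕ} (hp : τ p = i)
    (hskip : ∀ k, τ (skip p k) = skip i (σ k)) : (evSkip i σ).comp (insertT p i) = ev τ := by
  refine algHom_ext_x_t (fun j => ?_) fun j => by simp [ev_t]
  rw [AlgHom.comp_apply, ev_x]
  rcases eq_or_eq_skip p j with rfl | ⟨k, rfl⟩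
  · rw [insertT_x_self, evSkip_t, hp]
  · rw [insertT_x_skip, evSkip_x, hskip]

theorem simpleTransposition_skip_succ (i k : ℕ) :
    simpleTransposition i (skip (i + 1) k) = skip i k := by
  rcases eq_or_ne k i with rfl | h
  · rw [skip_of_lt (Nat.lt_succ_self k), skip_of_le le_rfl, simpleTransposition_self]
  · rw [show skip (i + 1) k = skip i k by unfold skip; split_ifs <;> omega,
      simpleTransposition_of_ne (skip_ne i k) (by unfold skip; split_ifs <;> omega)]

theorem evSkip_omitT (i : ℕ) (σ : Equiv.Perm ℕ) (g : PolTX) :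
    evSkip i σ (omitT i g) = rename (skip i) (ev σ g) := by
  have h : (evSkip i σ).comp (omitT i) = (rename (skip i)).comp (ev σ) :=
    algHom_ext_x_t (fun j => by simp [ev_x]) fun j => by simp [ev_t, omitT_t]
  exact DFunLike.congr_fun h g

theorem ev_shiftPerm_mul_sub (h : equivariantTrim i f = omitT i g) (σ : Equiv.Perm ℕ) :
    ev (shiftPerm i σ * simpleTransposition i) f - ev (shiftPerm i σ) f =
      (X (skip i (σ i)) - X i) * rename (skip i) (ev σ g) := by
  have hminus : (evSkip i σ).comp (insertT i i) = ev (shiftPerm i σ) :=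
    evSkip_comp_insertT (shiftPerm_self i σ) (shiftPerm_skip i σ)
  have hplus : (evSkip i σ).comp (insertT (i + 1) i) = ev (shiftPerm i σ * simpleTransposition i) :=
    evSkip_comp_insertT (by simp) fun k => by
      rw [Equiv.Perm.mul_apply, simpleTransposition_skip_succ, shiftPerm_skip]
  rw [← hminus, ← hplus, AlgHom.comp_apply, AlgHom.comp_apply, ← map_sub, ← insertDiff_apply,
    ← sub_mul_equivariantTrim, h, map_mul, evSkip_omitT, map_sub, evSkip_x, evSkip_t]

/-- The difference of the values at position `i` of the two permutations `insertDesc i σ` and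
`insertAsc i σ`, as a difference of parameters: the coefficient in `ev_insertDesc`. -/
noncomputable def insertWeight (i : ℕ) (σ : Equiv.Perm ℕ) : MvPolynomial ℕ ℤ :=
  if σ i < i then X i - X (σ i) else X (σ i + 1) - X i

theorem ev_insertDesc (h : equivariantTrim i f = omitT i g) (σ : Equiv.Perm ℕ) :
    ev (insertDesc i σ) f =
      ev (insertAsc i σ) f + insertWeight i σ * rename (skip i) (ev σ g) := by
  have hsub := ev_shiftPerm_mul_sub h σ
  unfold insertDesc insertAsc insertWeight
  split_ifs with hi
  · rw [skip_of_lt hi] at hsub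
    linear_combination -hsub
  · rw [skip_of_le (not_lt.1 hi)] at hsub
    linear_combination hsub

theorem ev_insertDesc_of_equivariantTrim_eq_zero (h : equivariantTrim i f = 0)
    (σ : Equiv.Perm ℕ) : ev (insertDesc i σ) f = ev (insertAsc i σ) f := by
  rw [ev_insertDesc (h.trans (map_zero _).symm), map_zero, map_zero, mul_zero, add_zero]

end EvInsert

section Positivity

variable {p q : MvPolynomial ℕ ℤ}

/-- A polynomial that is positive at all strictly increasing sequences. This is the notion of
positivity that excludes a cancellation in `ev_insertDesc`. -/
def IsPosOnStrictMono (p : MvPolynomial ℕ ℤ) : Prop := ∀ s : ℕ → ℤ, StrictMono s → 0 < eval s p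

namespace IsPosOnStrictMono

theorem one : IsPosOnStrictMono 1 := fun s _ => by
  rw [map_one]
  exact one_pos

theorem ne_zero (h : IsPosOnStrictMono p) : p ≠ 0 := by
  rintro rfl
  simpa using h _ Nat.strictMono_cast

theorem add (hp : IsPosOnStrictMono p) (hq : IsPosOnStrictMono q) : IsPosOnStrictMono (p + q) :=
  fun s hs => by
    rw [map_add]
    exact add_pos (hp s hs) (hq s hs)

theorem mul (hp : IsPosOnStrictMono p) (hq : IsPosOnStrictMono q) : IsPosOnStrictMono (p * q) :=
  fun s hs => by
    rw [map_mul]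
    exact mul_pos (hp s hs) (hq s hs)

theorem rename (hp : IsPosOnStrictMono p) {r : ℕ → ℕ} (hr : StrictMono r) :
    IsPosOnStrictMono (MvPolynomial.rename r p) := fun s hs => by
  rw [eval_rename]
  exact hp _ (hs.comp hr)

theorem X_sub_X {a b : ℕ} (h : a < b) : IsPosOnStrictMono (X b - X a) := fun s hs => by
  simpa using hs h

end IsPosOnStrictMono

theorem isPosOnStrictMono_insertWeight (i : ℕ) (σ : Equiv.Perm ℕ) :
    IsPosOnStrictMono (insertWeight i σ) := by
  unfold insertWeight
  split_ifs with h
  · exact .X_sub_X h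
  · exact .X_sub_X (Nat.lt_succ_of_le (not_lt.1 h))

end Positivity

section Dichotomy

variable {n m i : ℕ} {π σ : Equiv.Perm ℕ} {f g : PolTX} {F : IndexedForest}

/-- The polynomial `p` is positive at all strictly increasing sequences if `π` is below `σ`
with respect to `RankLE`, and zero otherwise. -/
def PosIffRankLE (π σ : Equiv.Perm ℕ) (p : MvPolynomial ℕ ℤ) : Prop :=
  (RankLE π σ → IsPosOnStrictMono p) ∧ (¬ RankLE π σ → p = 0)

theorem PosIffRankLE.eq_zero_iff {p : MvPolynomial ℕ ℤ} (h : PosIffRankLE π σ p) :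
    p = 0 ↔ ¬ RankLE π σ :=
  ⟨fun hp hr => (h.1 hr).ne_zero hp, h.2⟩

theorem PosIffRankLE.ev_insertDesc_insertDesc (hf : equivariantTrim i f = omitT i g)
    (hA : PosIffRankLE (insertDesc i π) (insertAsc i σ) (ev (insertAsc i σ) f))
    (hg : PosIffRankLE π σ (ev σ g)) :
    PosIffRankLE (insertDesc i π) (insertDesc i σ) (ev (insertDesc i σ) f) := by
  rw [PosIffRankLE, ev_insertDesc hf, rankLE_insertDesc_iff]
  constructor
  · intro hr
    have hpos := (isPosOnStrictMono_insertWeight i σ).mul ((hg.1 hr).rename (skip_strictMono i))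
    by_cases hrA : RankLE (insertDesc i π) (insertAsc i σ)
    · exact (hA.1 hrA).add hpos
    · rwa [hA.2 hrA, zero_add]
  · intro hr
    have hrA : ¬ RankLE (insertDesc i π) (insertAsc i σ) := fun h =>
      hr (rankLE_insertDesc_iff.1 (h.trans (rankLE_insertAsc_insertDesc i σ)))
    rw [hA.2 hrA, hg.2 hr, map_zero, mul_zero, add_zero]

theorem rankLE_insertDesc_iff_rankLE_insertAsc (hi : π i < i ∨ i < π (i + 1)) :
    RankLE π (insertDesc i σ) ↔ RankLE π (insertAsc i σ) :=
  ⟨fun h => h.insertAsc_of_insertDesc hi, fun h => h.trans (rankLE_insertAsc_insertDesc i σ)⟩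

theorem posIffRankLE_ev_one_doubleForestPoly (hF : F ∈ forestsOn m) :
    PosIffRankLE (F.forToNC m) 1 (ev 1 (doubleForestPoly F)) := by
  classical
  rw [ev_one_doubleForestPoly]
  have hempty := empty_mem_forestsOn m
  constructor
  · intro h
    rw [if_pos (IndexedForest.forToNC_injOn m hF hempty
      (h.eq_one.trans (IndexedForest.forToNC_empty m).symm))]
    exact .one
  · intro h
    refine if_neg fun hF => h ?_
    rw [hF, IndexedForest.forToNC_empty]
    exact fun _ => le_rfl

theorem posIffRankLE_ev_doubleForestPoly (hσ : σ ∈ noncrossingPerms n) (hF : F ∈ forestsOn m) :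
    PosIffRankLE (F.forToNC m) σ (ev σ (doubleForestPoly F)) := by
  induction hσ using noncrossingPerms_induction generalizing m F with
  | one => exact posIffRankLE_ev_one_doubleForestPoly hF
  | insert _ σ i _ _ ih ihAsc =>
    have hAsc := ihAsc hF
    by_cases hiF : i ∈ F.qDes
    · rw [← IndexedForest.graft_trim hiF] at hF hAsc ⊢
      obtain ⟨m, rfl, hG, him⟩ := IndexedForest.exists_of_graft_mem_forestsOn hF
      rw [IndexedForest.forToNC_graft hG him] at hAsc ⊢
      exact .ev_insertDesc_insertDesc (equivariantTrim_doubleForestPoly_graft _ i) hAsc (ih hG)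
    · have hi : F.forToNC m i < i ∨ i < F.forToNC m (i + 1) := by
        rwa [IndexedForest.mem_qDes_iff hF, not_and_or, not_le, not_le] at hiF
      rw [PosIffRankLE, rankLE_insertDesc_iff_rankLE_insertAsc hi,
        ev_insertDesc_of_equivariantTrim_eq_zero (equivariantTrim_doubleForestPoly_of_notMem hiF)]
      exact hAsc

end Dichotomy

/-! ### The Bruhat order on noncrossing permutations -/

section Bruhat

variable {n m i : ℕ} {π σ : Equiv.Perm ℕ} {F : IndexedForest} {w : List ℕ}

theorem IsExactWord.insertDesc (h : IsExactWord w (insertAsc i σ)) :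
    IsExactWord (w ++ [i]) (insertDesc i σ) := by
  rw [← insertAsc_mul]
  exact h.concat (insertAsc_lt i σ)

theorem exists_isExactWord (h : σ ∈ noncrossingPerms n) : ∃ w, IsExactWord w σ := by
  induction h using noncrossingPerms_induction with
  | one => exact ⟨[], isExactWord_nil⟩
  | insert _ σ i _ _ _ ihAsc => exact ihAsc.imp' (· ++ [i]) fun _ hw => hw.insertDesc

theorem RankLE.exists_sublist (h : RankLE π σ) (hπ : π ∈ noncrossingPerms m)
    (hσ : σ ∈ noncrossingPerms n) :
    ∃ v w, IsExactWord v π ∧ IsExactWord w σ ∧ v.Sublist w := by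
  induction hσ using noncrossingPerms_induction generalizing m π with
  | one => exact ⟨[], [], h.eq_one ▸ isExactWord_nil, isExactWord_nil, List.Sublist.refl _⟩
  | insert _ σ i _ _ _ ihAsc =>
    by_cases hi : π i < i ∨ i < π (i + 1)
    · obtain ⟨v, w, hv, hw, hvw⟩ := ihAsc (h.insertAsc_of_insertDesc hi) hπ
      exact ⟨v, w ++ [i], hv, hw.insertDesc, hvw.trans (List.sublist_append_left _ _)⟩
    · rw [not_or, not_lt, not_lt] at hi
      obtain ⟨m, rfl, him, τ, hτ, rfl⟩ := exists_eq_insertDesc hπ hi.1 hi.2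
      obtain ⟨v, w, hv, hw, hvw⟩ := ihAsc ((rankLE_insertDesc_iff.1 h).insertAsc i)
        (insertAsc_mem_noncrossingPerms hτ him)
      exact ⟨v ++ [i], w ++ [i], hv.insertDesc, hw.insertDesc, hvw.append_right _⟩

theorem bruhatLE_iff_rankLE (hπ : π ∈ noncrossingPerms m) (hσ : σ ∈ noncrossingPerms n) :
    BruhatLE π σ ↔ RankLE π σ := by
  refine ⟨fun h => h.rankLE (exists_isExactWord hσ), fun h => ?_⟩
  obtain ⟨v, w, hv, hw, hvw⟩ := h.exists_sublist hπ hσ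
  exact ⟨v, w, hv.isReducedWord, hw.isReducedWord, hvw⟩

theorem ev_doubleForestPoly_eq_zero_iff (hσ : σ ∈ noncrossingPerms n) (hF : F ∈ forestsOn m) :
    ev σ (doubleForestPoly F) = 0 ↔ ¬ BruhatLE (F.forToNC m) σ := by
  rw [bruhatLE_iff_rankLE (IndexedForest.forToNC_mem_noncrossingPerms hF) hσ]
  exact (posIffRankLE_ev_doubleForestPoly hσ hF).eq_zero_iff

end Bruhat

end DoubleForest

theorem theorem8p10 :
    (∃! P : IndexedForest → PolTX, IsDoubleForestFamily P) ∧
    ∀ n : ℕ,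
      Set.BijOn (IndexedForest.forToNC n) (forestsOn n) (noncrossingPerms n) ∧
      (∀ σ ∈ noncrossingPerms n, ∀ F ∈ forestsOn n,
        ev σ (doubleForestPoly F) = 0 ↔ ¬ BruhatLE (F.forToNC n) σ) ∧
      (∀ σ ∈ noncrossingPerms n, ∀ τ ∈ noncrossingPerms n,
        BruhatLE τ σ ↔
          ev σ (doubleForestPoly
            (Function.invFunOn (IndexedForest.forToNC n) (forestsOn n) τ)) ≠ 0) := by
  refine ⟨existsUnique_isDoubleForestFamily, fun n => ⟨IndexedForest.bijOn_forToNC n,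
    fun σ hσ F hF => ev_doubleForestPoly_eq_zero_iff hσ hF, fun σ hσ τ hτ => ?_⟩⟩
  have hex : ∃ F ∈ forestsOn n, F.forToNC n = τ := (IndexedForest.bijOn_forToNC n).surjOn hτ
  rw [ne_eq, ev_doubleForestPoly_eq_zero_iff hσ (Function.invFunOn_mem hex),
    Function.invFunOn_eq hex, not_not]
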